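/- **Setting.** There are $K$ nodes, a compact feature space $\mathcal X\subset\mathbb R^{d_0}$ and a finite label set $\mathcal Y$ with $|\mathcal Y|=m$. The class-conditional distributions $p(x\mid y)$ are common to all nodes and to training and test; the label distributions $p_k^{\mathrm{tr}}>0$ and $p_k^{\mathrm{te}}$ of node $k$ are arbitrary. Node $k$ holds labelled training data $(x_{k,i},y_{k,i})_{i\le n_k}$ and unlabelled test data, which are possible samples of its training and test distributions. *Density ratios.* Let $f=\mathrm{softmax}\circ s_\theta$, $\theta\in\Theta$, be a class of predictors, and let $\zeta>0$. Node $k$ trains $f_{\theta_k}$ by minimising over $\Theta$ the mean over its training data of the cross entropy plus $\zeta\sum_c f_c\log f_c$. For a predictor $f$, let $r_{k,j,f}$ be a maximiser of the mean of $\log(f(x)^\top r)$ over the test data of node $j$, among all $r\in\mathbb R_+^m$ with $\sum_y r_y\,p_k^{\mathrm{tr}}(y)=1$. Put $r_{k,f}=\sum_{j=1}^K r_{k,j,f}$ (an estimate of $\sum_j p_j^{\mathrm{te}}/p_k^{\mathrm{tr}}$), $r_k=r_{k,f_{\theta_k}}$, and $r_{\max}=\max_{k,y}\sup_f r_{k,f}(y)$;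 necessarily $r_{\max}\ge K$ when the estimates exist. *Objective.* For hypotheses $h_w$, $w\in\mathbb R^d$, and a loss $\ell\ge0$, put $$F_k(w)=\frac1{n_k}\sum_{i=1}^{n_k} r_k(y_{k,i})\,\ell(h_w(x_{k,i}),y_{k,i}),\qquad F=\frac1K\sum_{k=1}^K F_k .$$ *Training.* IW-ERM with $\tau$ local steps, $R$ rounds and constant step size $\eta$: starting from $w_0$, in each round every node makes $\tau$ steps $w\leftarrow w-\eta\,g_k(w,\xi)$ from the common model, with fresh independent samples $\xi$, and the local models are then averaged. Here $g_k(w,\xi)$ is a stochastic gradient with $\mathbb E\,g_k(w,\xi)=\nabla F_k(w)$ and $\mathbb E\|g_k(w,\xi)-\nabla F_k(w)\|^2\le\sigma^2$ for all $w$. Let $w_T$, $T=\tau R$, be the common model after $R$ rounds. **Theorem (Lower Bound for Convex and Second-order Differentiable Losses).** There is a universal constant $c>0$ such that for all integers $K\ge1$, $\tau\ge2$, $R\ge1$ and all reals $r_{\max}\ge K$, $\beta,D,\sigma>0$ there is a problem as above, with this value of $r_{\max}$ and exact ratio estimates $r_k(y)=\sum_j p_j^{\mathrm{te}}(y)/p_k^{\mathrm{tr}}(y)$,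 such that for every $x\in\mathcal X$, $y\in\mathcal Y$ the loss $w\mapsto\ell(h_w(x),y)$ is convex, $\beta$-smooth and twice continuously differentiable, all nodes have the same objective $F_k=F$, and there are stochastic gradients of variance at most $\sigma^2$, an initial point $w_0$ and a minimiser $w^\star$ of $F$ with $\|w_0-w^\star\|=D$, for which **every** constant step size $\eta>0$ (hence also the tuned one) satisfies $$\mathbb E[F(w_T)-F(w^\star)]\ \ge\ c\left(\frac{r_{\max}\beta D^2}{\tau R}+\min\Big\{\frac{(r_{\max}\beta\sigma^2D^4)^{1/3}}{(\sqrt\tau R)^{2/3}},\ \frac{\sigma D}{\sqrt{\tau R}},\ r_{\max}\beta D^2\Big\}+\min\Big\{\frac{\sigma D}{\sqrt{K\tau R}},\ r_{\max}\beta D^2\Big\}\right).$$ In particular, for this problem, whenever $\tau(r_{\max}\beta D)^2\le\sigma^2R$, $\ \sigma^2\le(r_{\max}\beta D)^2\tau R^2$ and $\sigma^2\le(r_{\max}\beta D)^2K\tau R$ (which holds for all large $R$ when the other parameters are fixed), every constant step size $\eta>0$ satisfies $$\mathbb E[F(w_T)-F(w^\star)]\ \ge\ c\left(\frac{r_{\max}\beta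 D^2}{\tau R}+\frac{(r_{\max}\beta\sigma^2D^4)^{1/3}}{(\sqrt\tau R)^{2/3}}+\frac{\sigma D}{\sqrt{K\tau R}}\right).$$ -/

import Mathlib

open MeasureTheory ProbabilityTheory

/-- The softmax map on `ℝ^m`. -/
noncomputable def softmax {m : ℕ} (s : Fin m → ℝ) (y : Fin m) : ℝ :=
  Real.exp (s y) / ∑ c, Real.exp (s c)

/-- Regularised training loss of one labelled sample for a predictor with logits `s`: cross entropy
plus `ζ` times the negative Shannon entropy `Ω = ∑ f_c log f_c` of the prediction `f = softmax s`. -/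
noncomputable def regularizedCE {m : ℕ} (ζ : ℝ) (s : Fin m → ℝ) (y : Fin m) : ℝ :=
  -Real.log (softmax s y) + ζ * ∑ c, softmax s c * Real.log (softmax s c)

/-- The ratio vectors that are compatible with the training label distribution `q`:
nonnegative vectors `r` with `∑ y, r y * q y = 1`. -/
def ratioSet {m : ℕ} (q : Fin m → ℝ) : Set (Fin m → ℝ) :=
  {r | (∀ y, 0 ≤ r y) ∧ ∑ y, r y * q y = 1}

/-- `r` is a ratio estimate `r_f` for the predictor `f = softmax ∘ logits`: it maximises the mean of
`log (f(x)ᵀ r)` over the unlabelled test samples `x`, among all ratio vectors compatible with the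
training label distribution `q`. -/
def IsRatioEstimate {m n : ℕ} {E : Type} (q : Fin m → ℝ) (logits : E → Fin m → ℝ)
    (xTe : Fin n → E) (r : Fin m → ℝ) : Prop :=
  r ∈ ratioSet q ∧
    IsMaxOn (fun r' : Fin m → ℝ =>
      (n : ℝ)⁻¹ * ∑ i, Real.log (∑ y, softmax (logits (xTe i)) y * r' y)) (ratioSet q) r

/-- A distributed learning problem with `K` nodes under label shift, together with the outcome of the
density ratio estimation phase. -/
structure IWERMProblem (K : ℕ) where
  /-- feature dimension -/
  d₀ : ℕ
  /-- number of labels -/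
  m : ℕ
  /-- dimension of the prediction space -/
  p : ℕ
  /-- number of model parameters -/
  d : ℕ
  /-- the feature space -/
  X : Set (EuclideanSpace ℝ (Fin d₀))
  isCompact_X : IsCompact X
  /-- the class-conditional distributions `p(x|y)`, common to all nodes, training and test -/
  classCond : Fin m → Measure (EuclideanSpace ℝ (Fin d₀))
  isProbabilityMeasure_classCond : ∀ y, IsProbabilityMeasure (classCond y)
  classCond_compl : ∀ y, classCond y Xᶜ = 0
  /-- training label distributions -/
  pTr : Fin K → Fin m → ℝ
  pTr_pos : ∀ k y, 0 < pTr k y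
  pTr_sum : ∀ k, ∑ y, pTr k y = 1
  /-- test label distributions -/
  pTe : Fin K → Fin m → ℝ
  pTe_nonneg : ∀ k y, 0 ≤ pTe k y
  pTe_sum : ∀ k, ∑ y, pTe k y = 1
  /-- sizes of the training sets -/
  nTr : Fin K → ℕ
  nTr_pos : ∀ k, 0 < nTr k
  /-- sizes of the unlabelled test sets -/
  nTe : Fin K → ℕ
  nTe_pos : ∀ k, 0 < nTe k
  /-- labelled training data, a possible sample of the training distribution of the node -/
  xTr : ∀ k, Fin (nTr k) → EuclideanSpace ℝ (Fin d₀)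
  yTr : ∀ k, Fin (nTr k) → Fin m
  xTr_mem : ∀ k i, xTr k i ∈ X ∩ (classCond (yTr k i)).support
  /-- unlabelled test data, a possible sample of the test distribution of the node -/
  xTe : ∀ k, Fin (nTe k) → EuclideanSpace ℝ (Fin d₀)
  xTe_mem : ∀ k i, ∃ y, 0 < pTe k y ∧ xTe k i ∈ X ∩ (classCond y).support
  /-- parameters of the predictors `f` used for ratio estimation -/
  Θ : Type
  /-- logits of the predictors -/
  logits : Θ → EuclideanSpace ℝ (Fin d₀) → Fin m → ℝ
  /-- strength of the entropy regularisation -/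
  ζ : ℝ
  ζ_pos : 0 < ζ
  /-- the predictor that node `k` obtains by training on its own training data -/
  θ : Fin K → Θ
  isMinOn_θ : ∀ k, IsMinOn
    (fun t => (nTr k : ℝ)⁻¹ * ∑ i, regularizedCE ζ (logits t (xTr k i)) (yTr k i)) Set.univ (θ k)
  /-- `rHat k j`: the estimate of the ratio of the test label distribution of node `j` to the training
  label distribution of node `k`, obtained with the trained predictor of node `k` -/
  rHat : Fin K → Fin K → Fin m → ℝ
  isRatioEstimate_rHat : ∀ k j, IsRatioEstimate (pTr k) (logits (θ k)) (xTe j) (rHat k j)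
  /-- the hypotheses `h_w` -/
  h : EuclideanSpace ℝ (Fin d) → EuclideanSpace ℝ (Fin d₀) → EuclideanSpace ℝ (Fin p)
  /-- the loss of a prediction against a label -/
  ℓ : EuclideanSpace ℝ (Fin p) → Fin m → ℝ
  ℓ_nonneg : ∀ z y, 0 ≤ ℓ z y

namespace IWERMProblem

variable {K : ℕ} (I : IWERMProblem K)

/-- The space of model parameters `w`. -/
abbrev W : Type := EuclideanSpace ℝ (Fin I.d)

/-- The true aggregated density ratio `∑ⱼ pⱼᵗᵉ(y) / pₖᵗʳ(y)`. -/
noncomputable def trueRatio (k : Fin K) (y : Fin I.m) : ℝ :=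
  (∑ j, I.pTe j y) / I.pTr k y

/-- The aggregated density ratio that node `k` uses as importance weight. -/
noncomputable def weight (k : Fin K) (y : Fin I.m) : ℝ := ∑ j, I.rHat k j y

/-- All values `r_f(y)` of aggregated ratio estimates, over all nodes, all predictors `f` of the class
and all labels `y`. -/
def ratioValues : Set ℝ :=
  {v | ∃ (k : Fin K) (t : I.Θ) (y : Fin I.m) (r : Fin K → Fin I.m → ℝ),
    (∀ j, IsRatioEstimate (I.pTr k) (I.logits t) (I.xTe j) (r j)) ∧ v = ∑ j, r j y}

/-- The importance-weighted empirical loss of node `k`. -/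
noncomputable def localObjective (k : Fin K) (w : I.W) : ℝ :=
  (I.nTr k : ℝ)⁻¹ * ∑ i, I.weight k (I.yTr k i) * I.ℓ (I.h w (I.xTr k i)) (I.yTr k i)

/-- The importance-weighted empirical loss, averaged over the nodes. -/
noncomputable def objective (w : I.W) : ℝ := (K : ℝ)⁻¹ * ∑ k, I.localObjective k w

/-- For every `x` and `y`, the loss `ℓ(h_w(x), y)` is convex, `β`-smooth and twice continuously
differentiable in `w`. -/
def ConvexSmoothC2 (β : ℝ) : Prop :=
  ∀ x ∈ I.X, ∀ y : Fin I.m,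
    ConvexOn ℝ Set.univ (fun w : I.W => I.ℓ (I.h w x) y) ∧
    ContDiff ℝ 2 (fun w : I.W => I.ℓ (I.h w x) y) ∧
    ∀ v w : I.W, ‖gradient (fun u : I.W => I.ℓ (I.h u x) y) v
      - gradient (fun u : I.W => I.ℓ (I.h u x) y) w‖ ≤ β * ‖v - w‖

/-- Stochastic gradients for the local objectives: unbiased, with variance at most `σ²`. -/
structure StochasticGradient (σ : ℝ) where
  Ξ : Type
  [measurableSpace : MeasurableSpace Ξ]
  ν : Measure Ξ
  [isProbabilityMeasure : IsProbabilityMeasure ν]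
  g : Fin K → I.W → Ξ → I.W
  measurable_g : ∀ k, Measurable (Function.uncurry (g k))
  memLp_g : ∀ k w, MemLp (g k w) 2 ν
  unbiased : ∀ k w, ∫ ξ, g k w ξ ∂ν = gradient (I.localObjective k) w
  variance_le : ∀ k w, ∫ ξ, ‖g k w ξ - gradient (I.localObjective k) w‖ ^ 2 ∂ν ≤ σ ^ 2

end IWERMProblem

attribute [instance] IWERMProblem.StochasticGradient.measurableSpace
  IWERMProblem.StochasticGradient.isProbabilityMeasure

/-- Iterates of `w ← w - η g(w, ξ_s)`, started at `w`. -/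
def sgdIterate {V Ξ : Type} [AddCommGroup V] [Module ℝ V]
    (η : ℝ) (g : V → Ξ → V) (ξ : ℕ → Ξ) (w : V) : ℕ → V
  | 0 => w
  | s + 1 => sgdIterate η g ξ w s - η • g (sgdIterate η g ξ w s) (ξ s)

/-- The common model after the given number of communication rounds: in each round every node makes
`τ` local steps from the common model, using the sample `ω (k, ρ, s)` in step `s` of round `ρ`, and
then the local models are averaged. -/
noncomputable def localSGD {V Ξ : Type} [AddCommGroup V] [Module ℝ V] {K : ℕ}
    (η : ℝ) (τ : ℕ) (g : Fin K → V → Ξ → V) (ω : Fin K × ℕ × ℕ → Ξ) (w₀ : V) : ℕ → V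
  | 0 => w₀
  | ρ + 1 => (K : ℝ)⁻¹ •
      ∑ k, sgdIterate η (g k) (fun s => ω (k, ρ, s)) (localSGD η τ g ω w₀ ρ) τ

/-- The expected suboptimality, relative to the point `wStar`, of the final model after `R` rounds
with `τ` local steps and constant step size `η`, all samples being independent. -/
noncomputable def expectedSuboptimality {K : ℕ} {I : IWERMProblem K} {σ : ℝ}
    (G : I.StochasticGradient σ) (η : ℝ) (τ R : ℕ) (w₀ wStar : I.W) : ℝ :=
  ∫ ω, (I.objective (localSGD η τ G.g ω w₀ R) - I.objective wStar)
    ∂(Measure.infinitePi (fun _ : Fin K × ℕ × ℕ => G.ν))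

/-! A separable function on `ℝ³` penalises every step size. With `L = rmax * β`, its third
coordinate is a quadratic of curvature `L`, which does not shrink when `η L ≥ 2`. Its second is a
quadratic of small curvature `μ`, which barely moves when `4 η μ τ R ≤ 1`. Only the first coordinate
carries noise, and it has to make the remaining range of `η` costly. It suffices to reach the
largest of the three terms of the bound, so each term gets its own parameters.

For the optimization term, `μ = L / (8 τ R)` leaves no range in between. For the statistical term
the first coordinate is a plain quadratic, and the noise left after averaging over `K` nodes has an
explicit second moment (`integral_sq_localSGD_ge`).

The middle term is the price of local steps. The gradient in the first coordinate is linear plus a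
nonnegative multiple of `bump δ x = δ (1 - cos (x / δ))`, which vanishes at the minimiser `0`.
During the first half of a round the noise spreads the local iterates over the scale `δ`; from then
on the bump has mean of order `δ` and pushes the mean of the iterates to the left. Averaging the
nodes reduces variance but leaves the mean unchanged, so a bias of order `δ` survives
(`integral_localSGD_le`), and the second moment is at least its square (`bias_lower_bound`). The
spreading is measured by the characteristic function of the dynamics without bump
(`norm_charFun_sgdIterate_le`), from which the true iterates differ pathwise by a fraction of `δ`
(`abs_sgdIterate_sub_le`).

Label shift enters only through the weights: if every training sample has a label of weight `rmax`,
the objective is `rmax` times a `β`-smooth loss. A balanced two-point test sample makes the ratio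
estimates exact and unique (`isRatioEstimate_bayes_iff`). -/

/-! ### Independent Gaussian samples -/

/-- Resampling one coordinate of a product measure preserves it. -/
theorem measurePreserving_update_infinitePi {ι Ξ : Type*} [DecidableEq ι] [MeasurableSpace Ξ]
    (ν : Measure Ξ) [IsProbabilityMeasure ν] (e : ι) :
    MeasurePreserving (fun p : (ι → Ξ) × Ξ => Function.update p.1 e p.2)
      ((Measure.infinitePi fun _ : ι => ν).prod ν) (Measure.infinitePi fun _ : ι => ν) := by
  have hm : Measurable (fun p : (ι → Ξ) × Ξ => Function.update p.1 e p.2) := by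
    rw [measurable_pi_iff]
    intro i
    by_cases hi : i = e
    · subst hi; simpa using measurable_snd
    · simp only [Function.update_of_ne hi]
      exact (measurable_pi_apply i).comp measurable_fst
  refine ⟨hm, Measure.eq_infinitePi _ fun s t ht => ?_⟩
  rw [Measure.map_apply hm (MeasurableSet.pi s.countable_toSet fun i _ => ht i)]
  -- It suffices to test boxes with finitely many constrained coordinates; the resampled coordinate
  -- supplies the factor for `e` exactly when `e` is constrained.
  by_cases he : e ∈ s
  · have : (fun p : (ι → Ξ) × Ξ => Function.update p.1 e p.2) ⁻¹' (Set.pi s t)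
        = (Set.pi (s.erase e : Finset ι) t) ×ˢ t e := by
      ext ⟨x, y⟩
      simp only [Set.mem_preimage, Set.mem_pi, Set.mem_prod, Finset.mem_coe, Finset.mem_erase]
      constructor
      · intro h
        refine ⟨fun i hi => ?_, by simpa using h e he⟩
        simpa [Function.update_of_ne hi.1] using h i hi.2
      · rintro ⟨h1, h2⟩ i hi
        by_cases hie : i = e
        · subst hie; simpa using h2
        · simpa [Function.update_of_ne hie] using h1 i ⟨hie, hi⟩
    rw [this, Measure.prod_prod, Measure.infinitePi_pi _ fun i _ => ht i,
      Finset.prod_erase_mul s (fun i => ν (t i)) he]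
  · have : (fun p : (ι → Ξ) × Ξ => Function.update p.1 e p.2) ⁻¹' (Set.pi s t)
        = (Set.pi s t) ×ˢ Set.univ := by
      ext ⟨x, y⟩
      simp only [Set.mem_preimage, Set.mem_pi, Set.mem_prod, Finset.mem_coe, Set.mem_univ, and_true]
      refine forall₂_congr fun i hi => ?_
      rw [Function.update_of_ne (by rintro rfl; exact he hi)]
    rw [this, Measure.prod_prod, Measure.infinitePi_pi _ fun i _ => ht i, measure_univ, mul_one]

/-- The law of independent standard Gaussian samples indexed by `ι`. -/
noncomputable abbrev gaussianSamples (ι : Type*) : Measure (ι → ℝ) :=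
  Measure.infinitePi fun _ : ι => gaussianReal 0 1

section Samples

variable {ι : Type*}

theorem memLp_gaussianSamples_eval (e : ι) :
    MemLp (fun ω : ι → ℝ => ω e) 2 (gaussianSamples ι) :=
  (memLp_id_gaussianReal' (μ := 0) (v := 1) 2 (by norm_num)).comp_measurePreserving
    (measurePreserving_eval_infinitePi (fun _ : ι => gaussianReal 0 1) e)

theorem integral_gaussianSamples_eval (e : ι) : ∫ ω, ω e ∂(gaussianSamples ι) = 0 := by
  have h := measurePreserving_eval_infinitePi (fun _ : ι => gaussianReal 0 1) e
  have := integral_map (μ := gaussianSamples ι) h.measurable.aemeasurable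
    (f := fun x : ℝ => x) measurable_id.aestronglyMeasurable
  rw [h.map_eq, integral_id_gaussianReal] at this
  simpa using this.symm

theorem integral_sq_gaussianReal : ∫ x, x ^ 2 ∂(gaussianReal 0 1) = 1 := by
  have h := variance_fun_id_gaussianReal (μ := 0) (v := 1)
  rw [variance_eq_integral (by fun_prop)] at h
  simpa using h

theorem integral_sq_gaussianSamples_eval (e : ι) : ∫ ω, ω e ^ 2 ∂(gaussianSamples ι) = 1 := by
  have h := measurePreserving_eval_infinitePi (fun _ : ι => gaussianReal 0 1) e
  have := integral_map (μ := gaussianSamples ι) h.measurable.aemeasurable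
    (f := fun x : ℝ => x ^ 2) (by fun_prop)
  rw [h.map_eq, integral_sq_gaussianReal] at this
  simpa using this.symm

variable [DecidableEq ι]

/-- A function that ignores coordinate `e` is independent of it: expectations of products
factorise. -/
theorem integral_mul_eval_of_update {𝕜 : Type*} [RCLike 𝕜] (e : ι) {u : (ι → ℝ) → 𝕜} {v : ℝ → 𝕜}
    (hu : AEStronglyMeasurable u (gaussianSamples ι)) (hv : Measurable v)
    (hue : ∀ ω ξ, u (Function.update ω e ξ) = u ω) :
    ∫ ω, u ω * v (ω e) ∂(gaussianSamples ι)
      = (∫ ω, u ω ∂(gaussianSamples ι)) * ∫ ξ, v ξ ∂(gaussianReal 0 1) := by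
  have h := measurePreserving_update_infinitePi (gaussianReal 0 1) e
  have hm : AEStronglyMeasurable (fun ω : ι → ℝ => u ω * v (ω e)) (gaussianSamples ι) :=
    hu.mul (hv.comp (measurable_pi_apply e)).aestronglyMeasurable
  have := integral_map (μ := (gaussianSamples ι).prod (gaussianReal 0 1))
    h.measurable.aemeasurable (f := fun ω : ι → ℝ => u ω * v (ω e)) (by rwa [h.map_eq])
  rw [h.map_eq] at this
  rw [this]
  simp only [hue, Function.update_self]
  exact integral_prod_mul u v

/-- The second moment of a linear combination of fresh samples added to a variable that ignores
them. -/
theorem integral_sq_add_sum_eval {u : (ι → ℝ) → ℝ} (hu : MemLp u 2 (gaussianSamples ι))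
    (c : ι → ℝ) (s : Finset ι) (hue : ∀ e ∈ s, ∀ ω ξ, u (Function.update ω e ξ) = u ω) :
    ∫ ω, (u ω + ∑ e ∈ s, c e * ω e) ^ 2 ∂(gaussianSamples ι)
      = (∫ ω, u ω ^ 2 ∂(gaussianSamples ι)) + ∑ e ∈ s, c e ^ 2 := by
  induction s using Finset.induction_on with
  | empty => simp
  | insert e s he ih =>
    have ih := ih fun i hi => hue i (Finset.mem_insert_of_mem hi)
    set U : (ι → ℝ) → ℝ := fun ω => u ω + ∑ e ∈ s, c e * ω e with hU
    have hUL : MemLp U 2 (gaussianSamples ι) :=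
      hu.add (memLp_finsetSum s fun i _ => (memLp_gaussianSamples_eval i).const_mul (c i))
    have hUe : ∀ ω ξ, U (Function.update ω e ξ) = U ω := by
      intro ω ξ
      simp only [hU, hue e (Finset.mem_insert_self e s)]
      congr 1
      refine Finset.sum_congr rfl fun i hi => ?_
      rw [Function.update_of_ne (by rintro rfl; exact he hi)]
    -- The cross term vanishes: `U` ignores the centred sample `ω e`.
    have h0 : ∫ ω, U ω * ω e ∂(gaussianSamples ι) = 0 := by
      have := integral_mul_eval_of_update e hUL.1 (v := fun x => x) measurable_id hUe
      simpa using this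
    have hexp : ∀ ω : ι → ℝ, (u ω + ∑ e ∈ insert e s, c e * ω e) ^ 2
        = U ω ^ 2 + (2 * c e) * (U ω * ω e) + c e ^ 2 * ω e ^ 2 := by
      intro ω
      rw [Finset.sum_insert he]
      simp only [hU]
      ring
    have hi1 : Integrable (fun ω => U ω * ω e) (gaussianSamples ι) :=
      MemLp.integrable_mul hUL (memLp_gaussianSamples_eval e)
    simp_rw [hexp]
    have hi2 : Integrable (fun ω => U ω ^ 2 + 2 * c e * (U ω * ω e)) (gaussianSamples ι) :=
      hUL.integrable_sq.add (hi1.const_mul _)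
    rw [integral_add hi2 ((memLp_gaussianSamples_eval e).integrable_sq.const_mul _),
      integral_add hUL.integrable_sq (hi1.const_mul _), integral_const_mul, integral_const_mul, h0,
      integral_sq_gaussianSamples_eval, ih, Finset.sum_insert he]
    ring

/-- Adding a fresh Gaussian sample multiplies the characteristic function by a Gaussian factor. -/
theorem norm_charFun_step (e : ι) {z : (ι → ℝ) → ℝ}
    (hz : AEStronglyMeasurable z (gaussianSamples ι))
    (hze : ∀ ω ξ, z (Function.update ω e ξ) = z ω) (c θ : ℝ) :
    ‖∫ ω, Complex.exp ((θ * (z ω + c * ω e) : ℝ) * Complex.I) ∂(gaussianSamples ι)‖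
      = ‖∫ ω, Complex.exp ((θ * z ω : ℝ) * Complex.I) ∂(gaussianSamples ι)‖
        * Real.exp (-((θ * c) ^ 2 / 2)) := by
  have h1 : ∀ ω : ι → ℝ, Complex.exp ((θ * (z ω + c * ω e) : ℝ) * Complex.I)
      = Complex.exp ((θ * z ω : ℝ) * Complex.I) *
        (fun ξ : ℝ => Complex.exp ((θ * c : ℝ) * ξ * Complex.I)) (ω e) := by
    intro ω
    rw [← Complex.exp_add]
    congr 1
    push_cast
    ring
  simp_rw [h1]
  rw [integral_mul_eval_of_update (𝕜 := ℂ) e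
      (u := fun ω => Complex.exp ((θ * z ω : ℝ) * Complex.I))
      (v := fun ξ : ℝ => Complex.exp ((θ * c : ℝ) * ξ * Complex.I)),
    norm_mul, ← charFun_apply_real, charFun_gaussianReal]
  · congr 1
    rw [Complex.norm_exp]
    congr 1
    simp
    norm_cast
  · exact (by fun_prop : Continuous fun x : ℝ => Complex.exp ((θ * x : ℝ) * Complex.I)
      ).comp_aestronglyMeasurable hz
  · fun_prop
  · intro ω ξ; simp only [hze]

end Samples

/-! ### Elementary inequalities for powers -/

/-- Partial sums of `(1 - y)^(2j)` are at least `n / (1 + 2 n y)`. -/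
theorem div_le_sum_one_sub_pow_two_mul {y : ℝ} (h0 : 0 ≤ y) (n : ℕ) :
    n / (1 + 2 * n * y) ≤ ∑ j ∈ Finset.range n, ((1 - y) ^ 2) ^ j := by
  induction n with
  | zero => simp
  | succ n ih =>
    -- Splitting off the term `j = 0` gives the recursion `S (n + 1) = (1 - y) ^ 2 * S n + 1`.
    rw [Finset.sum_range_succ']
    simp only [pow_zero, pow_succ _ _, ← Finset.sum_mul]
    have hn : (0 : ℝ) ≤ n := Nat.cast_nonneg n
    have hd : 0 < 1 + 2 * n * y := by positivity
    have hd' : 0 < 1 + 2 * (n + 1 : ℝ) * y := by positivity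
    have h2 : (n : ℝ) / (1 + 2 * n * y) * (1 - y) ^ 2 + 1 ≤
        (∑ j ∈ Finset.range n, ((1 - y) ^ 2) ^ j) * (1 - y) ^ 2 + 1 := by gcongr
    simp only [pow_succ, pow_zero, one_mul] at h2 ⊢
    refine le_trans ?_ h2
    push_cast
    rw [div_le_iff₀ hd']
    have : (n / (1 + 2 * n * y) * ((1 - y) * (1 - y)) + 1) * (1 + 2 * (n + 1 : ℝ) * y)
       = ((n * ((1 - y) * (1 - y)) + (1 + 2 * n * y)) * (1 + 2 * (n + 1 : ℝ) * y))
          / (1 + 2 * n * y) := by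
      field_simp
    rw [this, le_div_iff₀ hd]
    nlinarith [mul_nonneg hn h0, mul_nonneg hn (mul_nonneg h0 h0),
      mul_nonneg (mul_nonneg hn hn) (mul_nonneg h0 (mul_nonneg h0 h0)),
      mul_nonneg hn (mul_nonneg h0 (mul_nonneg h0 h0)),
      mul_nonneg (mul_nonneg hn hn) (mul_nonneg h0 h0)]

/-- `(1 - y)^n ≤ 1 / (1 + n y)`. -/
theorem one_sub_pow_le_inv {y : ℝ} (h0 : 0 ≤ y) (h1 : y ≤ 1) (n : ℕ) :
    (1 - y) ^ n ≤ 1 / (1 + n * y) := by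
  have hn : (0 : ℝ) ≤ n := Nat.cast_nonneg n
  rw [le_div_iff₀ (by positivity)]
  calc (1 - y) ^ n * (1 + n * y) ≤ (1 - y) ^ n * (1 + y) ^ n := by
        refine mul_le_mul_of_nonneg_left ?_ (pow_nonneg (by linarith) n)
        exact one_add_mul_le_pow (by linarith) n
    _ = ((1 - y) * (1 + y)) ^ n := (mul_pow _ _ _).symm
    _ ≤ 1 := pow_le_one₀ (by nlinarith) (by nlinarith)

/-! ### The bump and the iterations -/

/-- The nonnegative periodic perturbation of the gradient, of amplitude and period of order `δ`. -/
noncomputable def bump (δ x : ℝ) : ℝ := δ * (1 - Real.cos (x / δ))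

theorem bump_nonneg {δ : ℝ} (hδ : 0 < δ) (x : ℝ) : 0 ≤ bump δ x :=
  mul_nonneg hδ.le (by linarith [Real.cos_le_one (x / δ)])

theorem bump_le {δ : ℝ} (hδ : 0 < δ) (x : ℝ) : bump δ x ≤ 2 * δ := by
  unfold bump; nlinarith [Real.neg_one_le_cos (x / δ)]

theorem continuous_bump (δ : ℝ) : Continuous (bump δ) := by unfold bump; fun_prop

/-- Amplitude and period scale together, so the Lipschitz constant is `1` for every `δ`; hence `δ`
can be tuned without affecting smoothness or convexity. -/
theorem abs_bump_sub_le {δ : ℝ} (hδ : 0 < δ) (x y : ℝ) : |bump δ x - bump δ y| ≤ |x - y| := by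
  have h : bump δ x - bump δ y = δ * (Real.cos (y / δ) - Real.cos (x / δ)) := by unfold bump; ring
  have h2 := Real.abs_cos_sub_cos_le (y / δ) (x / δ)
  rw [h, abs_mul, abs_of_pos hδ]
  calc δ * |Real.cos (y / δ) - Real.cos (x / δ)| ≤ δ * |y / δ - x / δ| := by gcongr
    _ = |x - y| := by
      rw [← sub_div, abs_div, abs_of_pos hδ, mul_div_cancel₀ _ hδ.ne', abs_sub_comm]

/-- Stochastic gradient in one dimension: a linear term, a nonnegative bump and additive noise. -/
noncomputable def bumpGradient (a b δ n x ξ : ℝ) : ℝ := a * x + b * bump δ x + n * ξ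

/-- `sgdIterate` only looks at the samples it has used. -/
theorem sgdIterate_congr {V Ξ : Type} [AddCommGroup V] [Module ℝ V] (η : ℝ) (g : V → Ξ → V)
    {ξ ξ' : ℕ → Ξ} (w : V) {s : ℕ} (h : ∀ i < s, ξ i = ξ' i) :
    sgdIterate η g ξ w s = sgdIterate η g ξ' w s := by
  induction s with
  | zero => rfl
  | succ s ih =>
    simp only [sgdIterate, ih fun i hi => h i (by omega), h s (by omega)]

/-- `localSGD` only looks at the samples of past rounds. -/
theorem localSGD_congr {V Ξ : Type} [AddCommGroup V] [Module ℝ V] {K : ℕ} (η : ℝ) (τ : ℕ)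
    (g : Fin K → V → Ξ → V) {ω ω' : Fin K × ℕ × ℕ → Ξ} (w : V) {ρ : ℕ}
    (h : ∀ k, ∀ i < ρ, ∀ s, ω (k, i, s) = ω' (k, i, s)) :
    localSGD η τ g ω w ρ = localSGD η τ g ω' w ρ := by
  induction ρ with
  | zero => rfl
  | succ ρ ih =>
    simp only [localSGD, ih fun k i hi => h k i (by omega)]
    congr 1
    exact Finset.sum_congr rfl fun k _ => sgdIterate_congr _ _ _ fun i _ => h k ρ (by omega) i

/-! ### One round of local steps in one dimension -/

section Dynamics

variable {K : ℕ} {η : ℝ} {τ : ℕ} {a b δ n : ℝ}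

/-- Past iterates are independent of the current samples; this form feeds the hypothesis `hue` of
the expectation lemmas. -/
theorem localSGD_update (g : Fin K → ℝ → ℝ → ℝ) (x₀ : ℝ) (ρ : ℕ) (k : Fin K) (s : ℕ)
    (ω : Fin K × ℕ × ℕ → ℝ) (ξ : ℝ) :
    localSGD η τ g (Function.update ω (k, ρ, s) ξ) x₀ ρ = localSGD η τ g ω x₀ ρ :=
  localSGD_congr _ _ _ _ fun k' i hi s' =>
    Function.update_of_ne (by simp only [ne_eq, Prod.mk.injEq, not_and]; omega) _ _

theorem sgdIterate_update (g : ℝ → ℝ → ℝ) (ρ : ℕ) (k : Fin K) (s : ℕ)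
    (ω : Fin K × ℕ × ℕ → ℝ) (ξ : ℝ) (w : ℝ) :
    sgdIterate η g (fun i => Function.update ω (k, ρ, s) ξ (k, ρ, i)) w s
      = sgdIterate η g (fun i => ω (k, ρ, i)) w s :=
  sgdIterate_congr _ _ _ fun i hi =>
    Function.update_of_ne (by simp only [ne_eq, Prod.mk.injEq, not_and]; omega) _ _

theorem memLp_bump {ι : Type*} (hδ : 0 < δ) {x : (ι → ℝ) → ℝ}
    (hx : AEStronglyMeasurable x (gaussianSamples ι)) :
    MemLp (fun ω => bump δ (x ω)) 2 (gaussianSamples ι) :=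
  MemLp.of_bound ((continuous_bump δ).comp_aestronglyMeasurable hx) (2 * δ)
    (.of_forall fun ω => by
      rw [Real.norm_eq_abs, abs_of_nonneg (bump_nonneg hδ _)]; exact bump_le hδ _)

theorem memLp_sgdIterate (hδ : 0 < δ) {u : (Fin K × ℕ × ℕ → ℝ) → ℝ}
    (hu : MemLp u 2 (gaussianSamples (Fin K × ℕ × ℕ))) (k : Fin K) (ρ s : ℕ) :
    MemLp (fun ω => sgdIterate η (bumpGradient a b δ n) (fun i => ω (k, ρ, i)) (u ω) s) 2
      (gaussianSamples (Fin K × ℕ × ℕ)) := by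
  induction s with
  | zero => exact hu
  | succ s ih =>
    exact ih.sub ((((ih.const_mul a).add ((memLp_bump hδ ih.1).const_mul b)).add
      ((memLp_gaussianSamples_eval (k, ρ, s)).const_mul n)).const_mul η)

theorem memLp_localSGD (hδ : 0 < δ) (x₀ : ℝ) (ρ : ℕ) :
    MemLp (fun ω => localSGD η τ (fun _ : Fin K => bumpGradient a b δ n) ω x₀ ρ) 2
      (gaussianSamples (Fin K × ℕ × ℕ)) := by
  induction ρ with
  | zero => exact memLp_const x₀
  | succ ρ ih =>
    exact (memLp_finsetSum Finset.univ fun k _ => memLp_sgdIterate hδ ih k ρ τ).const_mul (K : ℝ)⁻¹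

/-- The centred noise drops out of the mean, so the bump is the only departure from geometric
contraction. -/
theorem integral_sgdIterate_succ (hδ : 0 < δ) {u : (Fin K × ℕ × ℕ → ℝ) → ℝ}
    (hu : MemLp u 2 (gaussianSamples (Fin K × ℕ × ℕ))) (k : Fin K) (ρ s : ℕ) :
    ∫ ω, sgdIterate η (bumpGradient a b δ n) (fun i => ω (k, ρ, i)) (u ω) (s + 1)
        ∂(gaussianSamples (Fin K × ℕ × ℕ))
      = (1 - a * η) * (∫ ω, sgdIterate η (bumpGradient a b δ n) (fun i => ω (k, ρ, i)) (u ω) s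
        ∂(gaussianSamples (Fin K × ℕ × ℕ)))
        - η * b * ∫ ω, bump δ (sgdIterate η (bumpGradient a b δ n) (fun i => ω (k, ρ, i)) (u ω) s)
        ∂(gaussianSamples (Fin K × ℕ × ℕ)) := by
  have hX := memLp_sgdIterate (η := η) (a := a) (b := b) (n := n) hδ hu k ρ s
  set X := fun ω : Fin K × ℕ × ℕ → ℝ =>
    sgdIterate η (bumpGradient a b δ n) (fun i => ω (k, ρ, i)) (u ω) s with hXdef
  have hB := memLp_bump hδ hX.1
  have hX1 : Integrable X (gaussianSamples (Fin K × ℕ × ℕ)) := hX.integrable (by norm_num)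
  have hB1 := hB.integrable (by norm_num)
  have hn1 := (memLp_gaussianSamples_eval (k, ρ, s)).integrable (by norm_num)
  have hstep : ∀ ω : Fin K × ℕ × ℕ → ℝ,
      sgdIterate η (bumpGradient a b δ n) (fun i => ω (k, ρ, i)) (u ω) (s + 1)
        = ((1 - a * η) * X ω - η * b * bump δ (X ω)) - η * n * ω (k, ρ, s) := by
    intro ω
    simp only [sgdIterate, bumpGradient, smul_eq_mul, hXdef]
    ring
  have hi : Integrable (fun ω => (1 - a * η) * X ω - η * b * bump δ (X ω))
      (gaussianSamples (Fin K × ℕ × ℕ)) := (hX1.const_mul _).sub (hB1.const_mul _)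
  simp_rw [hstep]
  rw [integral_sub hi (hn1.const_mul _), integral_sub (hX1.const_mul _) (hB1.const_mul _),
    integral_const_mul, integral_const_mul, integral_const_mul, integral_gaussianSamples_eval]
  ring

/-- The characteristic function of an autoregressive Gaussian process decays. -/
theorem norm_charFun_sgdIterate_le {u : (Fin K × ℕ × ℕ → ℝ) → ℝ}
    (hu : MemLp u 2 (gaussianSamples (Fin K × ℕ × ℕ))) (k : Fin K) (ρ s : ℕ)
    (hue : ∀ i ω ξ, u (Function.update ω (k, ρ, i) ξ) = u ω) (θ : ℝ) :
    ‖∫ ω, Complex.exp ((θ * sgdIterate η (bumpGradient a 0 1 n) (fun i => ω (k, ρ, i)) (u ω) s : ℝ)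
        * Complex.I) ∂(gaussianSamples (Fin K × ℕ × ℕ))‖
      ≤ Real.exp (-((θ * (η * n)) ^ 2 / 2 * ∑ j ∈ Finset.range s, ((1 - a * η) ^ 2) ^ j)) := by
  induction s generalizing θ with
  | zero =>
    simp only [Finset.range_zero, Finset.sum_empty, mul_zero, neg_zero, Real.exp_zero]
    refine (norm_integral_le_integral_norm _).trans ?_
    simp only [Complex.norm_exp_ofReal_mul_I]
    simp
  | succ s ih =>
    have hX := memLp_sgdIterate (η := η) (a := a) (b := 0) (n := n) one_pos hu k ρ s
    have hstep : ∀ ω : Fin K × ℕ × ℕ → ℝ,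
        sgdIterate η (bumpGradient a 0 1 n) (fun i => ω (k, ρ, i)) (u ω) (s + 1)
          = (1 - a * η) * sgdIterate η (bumpGradient a 0 1 n) (fun i => ω (k, ρ, i)) (u ω) s
            + (-(η * n)) * ω (k, ρ, s) := by
      intro ω
      simp only [sgdIterate, bumpGradient, smul_eq_mul]
      ring
    simp_rw [hstep]
    rw [norm_charFun_step (k, ρ, s)
      (z := fun ω => (1 - a * η) *
        sgdIterate η (bumpGradient a 0 1 n) (fun i => ω (k, ρ, i)) (u ω) s)
      (hX.const_mul _).1 (fun ω ξ => by simp only [hue, sgdIterate_update])]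
    -- A step contracts by `1 - a * η`, which rescales the frequency; the induction therefore runs
    -- over all `θ`.
    have := ih (θ * (1 - a * η))
    simp only [mul_assoc θ] at this
    refine (mul_le_mul_of_nonneg_right this (Real.exp_pos _).le).trans ?_
    rw [← Real.exp_add, Finset.sum_range_succ']
    refine le_of_eq (congrArg Real.exp ?_)
    simp only [pow_succ _ (_ : ℕ), ← Finset.sum_mul, pow_zero]
    ring

/-- The bump moves the iterates only by a fraction of its period away from the linear dynamics. -/
theorem abs_sgdIterate_sub_le (hδ : 0 < δ) (ha : 0 < a) (hb : 0 ≤ b) (hη : 0 < η)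
    (haη : a * η ≤ 1) (ξ : ℕ → ℝ) (w : ℝ) (s : ℕ) :
    |sgdIterate η (bumpGradient a b δ n) ξ w s - sgdIterate η (bumpGradient a 0 1 n) ξ w s|
      ≤ 2 * b * δ / a := by
  induction s with
  | zero => simp only [sgdIterate, sub_self, abs_zero]; positivity
  | succ s ih =>
    simp only [sgdIterate, bumpGradient, smul_eq_mul]
    set x := sgdIterate η (bumpGradient a b δ n) ξ w s
    set z := sgdIterate η (bumpGradient a 0 1 n) ξ w s
    have h0 := bump_nonneg hδ x
    have h1 := bump_le hδ x
    have : x - η * (a * x + b * bump δ x + n * ξ s) - (z - η * (a * z + 0 * bump 1 z + n * ξ s))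
        = (1 - a * η) * (x - z) - η * b * bump δ x := by ring
    rw [this]
    calc |(1 - a * η) * (x - z) - η * b * bump δ x|
        ≤ |(1 - a * η) * (x - z)| + |η * b * bump δ x| := abs_sub _ _
      _ = (1 - a * η) * |x - z| + η * b * bump δ x := by
          rw [abs_mul, abs_of_nonneg (by linarith : 0 ≤ 1 - a * η),
            abs_of_nonneg (by positivity : 0 ≤ η * b * bump δ x)]
      -- The bound `2 * b * δ / a` is the fixed point of `t ↦ (1 - a * η) * t + η * b * (2 * δ)`.
      _ ≤ (1 - a * η) * (2 * b * δ / a) + η * b * (2 * δ) := by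
          gcongr
      _ = 2 * b * δ / a := by field_simp; ring

/-- At frequency `1 / δ`, hypothesis `hs` forces the characteristic function of the linear dynamics
below `exp (-1) ≤ 1 / 2`, so there the bump has mean at least `δ / 2`. Running the true dynamics
with the same noise costs at most `2 * b * δ / a ≤ δ / 4`, as the bump is 1-Lipschitz. -/
theorem le_integral_bump (hδ : 0 < δ) (ha : 0 < a) (hb : 0 ≤ b) (hab : 8 * b ≤ a) (hη : 0 < η)
    (haη : a * η ≤ 1) {u : (Fin K × ℕ × ℕ → ℝ) → ℝ}
    (hu : MemLp u 2 (gaussianSamples (Fin K × ℕ × ℕ))) (k : Fin K) (ρ s : ℕ)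
    (hue : ∀ i ω ξ, u (Function.update ω (k, ρ, i) ξ) = u ω)
    (hs : 2 * δ ^ 2 ≤ (η * n) ^ 2 * ∑ j ∈ Finset.range s, ((1 - a * η) ^ 2) ^ j) :
    δ / 4 ≤ ∫ ω, bump δ (sgdIterate η (bumpGradient a b δ n) (fun i => ω (k, ρ, i)) (u ω) s)
        ∂(gaussianSamples (Fin K × ℕ × ℕ)) := by
  have hX := memLp_sgdIterate (η := η) (a := a) (b := b) (n := n) hδ hu k ρ s
  have hZ := memLp_sgdIterate (η := η) (a := a) (b := 0) (n := n) one_pos hu k ρ s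
  set X := fun ω : Fin K × ℕ × ℕ → ℝ =>
    sgdIterate η (bumpGradient a b δ n) (fun i => ω (k, ρ, i)) (u ω) s with hXdef
  set Z := fun ω : Fin K × ℕ × ℕ → ℝ =>
    sgdIterate η (bumpGradient a 0 1 n) (fun i => ω (k, ρ, i)) (u ω) s with hZdef
  have hcos : ∫ ω, Real.cos (Z ω / δ) ∂(gaussianSamples (Fin K × ℕ × ℕ)) ≤ 1 / 2 := by
    have hc := norm_charFun_sgdIterate_le (η := η) (a := a) (n := n) hu k ρ s hue δ⁻¹
    have hint : Integrable (fun ω => Complex.exp ((δ⁻¹ * Z ω : ℝ) * Complex.I))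
        (gaussianSamples (Fin K × ℕ × ℕ)) :=
      Integrable.of_bound ((by fun_prop : Continuous fun x : ℝ =>
        Complex.exp ((δ⁻¹ * x : ℝ) * Complex.I)).comp_aestronglyMeasurable hZ.1) 1
        (.of_forall fun ω => by rw [Complex.norm_exp_ofReal_mul_I])
    have hre := integral_re hint
    have hre2 : ∀ ω, Real.cos (Z ω / δ)
        = RCLike.re (Complex.exp ((δ⁻¹ * Z ω : ℝ) * Complex.I)) := by
      intro ω
      rw [RCLike.re_eq_complex_re, Complex.exp_ofReal_mul_I_re, div_eq_inv_mul]
    simp_rw [hre2]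
    rw [hre]
    refine (Complex.re_le_norm _).trans (hc.trans ?_)
    have h1 : (1 : ℝ) ≤ (δ⁻¹ * (η * n)) ^ 2 / 2 * ∑ j ∈ Finset.range s, ((1 - a * η) ^ 2) ^ j := by
      have : (δ⁻¹ * (η * n)) ^ 2 / 2 * ∑ j ∈ Finset.range s, ((1 - a * η) ^ 2) ^ j
          = ((η * n) ^ 2 * ∑ j ∈ Finset.range s, ((1 - a * η) ^ 2) ^ j) / (2 * δ ^ 2) := by
        field_simp
      rw [this, le_div_iff₀ (by positivity), one_mul]
      exact hs
    calc Real.exp (-((δ⁻¹ * (η * n)) ^ 2 / 2 * ∑ j ∈ Finset.range s, ((1 - a * η) ^ 2) ^ j))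
        ≤ Real.exp (-1) := Real.exp_le_exp.2 (by linarith)
      _ ≤ 1 / 2 := by
        rw [Real.exp_neg, one_div]
        exact inv_anti₀ (by norm_num) (by linarith [Real.add_one_le_exp 1])
  have hbZ : ∫ ω, bump δ (Z ω) ∂(gaussianSamples (Fin K × ℕ × ℕ))
      = δ * (1 - ∫ ω, Real.cos (Z ω / δ) ∂(gaussianSamples (Fin K × ℕ × ℕ))) := by
    have hci : Integrable (fun ω => Real.cos (Z ω / δ)) (gaussianSamples (Fin K × ℕ × ℕ)) :=
      Integrable.of_bound ((by fun_prop : Continuous fun x : ℝ => Real.cos (x / δ)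
        ).comp_aestronglyMeasurable hZ.1) 1 (.of_forall fun ω => Real.abs_cos_le_one _)
    simp only [bump]
    rw [integral_const_mul, integral_sub (integrable_const _) hci]
    simp
  have hle : ∫ ω, (bump δ (Z ω) - δ / 4) ∂(gaussianSamples (Fin K × ℕ × ℕ))
      ≤ ∫ ω, bump δ (X ω) ∂(gaussianSamples (Fin K × ℕ × ℕ)) := by
    refine integral_mono (((memLp_bump hδ hZ.1).integrable (by norm_num)).sub (integrable_const _))
      ((memLp_bump hδ hX.1).integrable (by norm_num)) fun ω => ?_
    have h1 := (abs_le.1 (abs_bump_sub_le hδ (X ω) (Z ω))).1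
    have h2 : |X ω - Z ω| ≤ 2 * b * δ / a :=
      abs_sgdIterate_sub_le hδ ha hb hη haη (fun i => ω (k, ρ, i)) (u ω) s
    have h3 : 2 * b * δ / a ≤ δ / 4 := by
      rw [div_le_div_iff₀ ha (by norm_num)]
      nlinarith
    simp only
    linarith
  rw [integral_sub ((memLp_bump hδ hZ.1).integrable (by norm_num)) (integrable_const _),
    hbZ] at hle
  simp only [integral_const, probReal_univ, smul_eq_mul, one_mul] at hle
  nlinarith

end Dynamics

/-! ### Means and second moments over the rounds -/

section Rounds

variable {K : ℕ} {η : ℝ} {τ : ℕ} {a b δ n : ℝ}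

/-- In each round the bump pushes the mean of the local iterates to the left. -/
theorem integral_sgdIterate_le (hδ : 0 < δ) (ha : 0 < a) (hb : 0 ≤ b) (hab : 8 * b ≤ a)
    (hη : 0 < η) (haη : a * η ≤ 1)
    (hs : 2 * δ ^ 2 ≤ (η * n) ^ 2 * ∑ j ∈ Finset.range (τ / 2), ((1 - a * η) ^ 2) ^ j)
    {u : (Fin K × ℕ × ℕ → ℝ) → ℝ}
    (hu : MemLp u 2 (gaussianSamples (Fin K × ℕ × ℕ))) (k : Fin K) (ρ : ℕ)
    (hue : ∀ i ω ξ, u (Function.update ω (k, ρ, i) ξ) = u ω) :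
    ∫ ω, sgdIterate η (bumpGradient a b δ n) (fun i => ω (k, ρ, i)) (u ω) τ
        ∂(gaussianSamples (Fin K × ℕ × ℕ))
      ≤ (1 - a * η) ^ τ * (∫ ω, u ω ∂(gaussianSamples (Fin K × ℕ × ℕ)))
        - b * δ / (8 * a) * (1 - (1 - a * η) ^ τ) := by
  set q := 1 - a * η with hq
  have hq0 : 0 ≤ q := by linarith
  have hq1 : q ≤ 1 := by have := mul_pos ha hη; linarith
  set e : ℕ → ℝ := fun s => ∫ ω, sgdIterate η (bumpGradient a b δ n) (fun i => ω (k, ρ, i)) (u ω) s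
        ∂(gaussianSamples (Fin K × ℕ × ℕ)) with he
  have hstep := integral_sgdIterate_succ (η := η) (a := a) (b := b) (n := n) hδ hu k ρ
  -- In the first half of the round only the sign of the bump is used.
  have h1 : ∀ s, e s ≤ q ^ s * ∫ ω, u ω ∂(gaussianSamples (Fin K × ℕ × ℕ)) := by
    intro s
    induction s with
    | zero => simp [he, sgdIterate]
    | succ s ih =>
      have hB : 0 ≤ ∫ ω, bump δ (sgdIterate η (bumpGradient a b δ n) (fun i => ω (k, ρ, i)) (u ω) s)
        ∂(gaussianSamples (Fin K × ℕ × ℕ)) := integral_nonneg fun ω => bump_nonneg hδ _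
      have h2 := mul_le_mul_of_nonneg_left ih hq0
      have h3 : e (s + 1) = _ := hstep s
      rw [h3, pow_succ']
      have : 0 ≤ η * b := by positivity
      nlinarith [mul_nonneg this hB]
  -- In the second half the noise has spread enough for every step to push by `η * b * (δ / 4)`.
  have h2 : ∀ i, e (τ / 2 + i) ≤ q ^ (τ / 2 + i) * (∫ ω, u ω ∂(gaussianSamples (Fin K × ℕ × ℕ)))
      - η * b * (δ / 4) * ∑ j ∈ Finset.range i, q ^ j := by
    intro i
    induction i with
    | zero => simpa using h1 (τ / 2)
    | succ i ih =>
      have hmono : ∑ j ∈ Finset.range (τ / 2), ((1 - a * η) ^ 2) ^ j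
          ≤ ∑ j ∈ Finset.range (τ / 2 + i), ((1 - a * η) ^ 2) ^ j :=
        Finset.sum_le_sum_of_subset_of_nonneg (Finset.range_mono (by omega))
          fun _ _ _ => by positivity
      have hB := le_integral_bump hδ ha hb hab hη haη hu k ρ (τ / 2 + i) hue
        (hs.trans (mul_le_mul_of_nonneg_left hmono (sq_nonneg _)))
      have h2 := mul_le_mul_of_nonneg_left ih hq0
      have h3 : e (τ / 2 + i + 1) = _ := hstep (τ / 2 + i)
      rw [← add_assoc, h3, pow_succ', Finset.sum_range_succ']
      simp only [pow_succ', ← Finset.mul_sum, pow_zero]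
      have : 0 ≤ η * b := by positivity
      nlinarith [mul_le_mul_of_nonneg_left hB this]
  have h3 := h2 (τ - τ / 2)
  rw [show τ / 2 + (τ - τ / 2) = τ by omega] at h3
  -- The powers decrease, so the first `τ - τ / 2 ≥ τ / 2` of them make up at least half of the sum;
  -- this turns the `4` into the `8` of the claim.
  have h4 : ∑ j ∈ Finset.range τ, q ^ j ≤ 2 * ∑ j ∈ Finset.range (τ - τ / 2), q ^ j := by
    have : ∑ j ∈ Finset.range τ, q ^ j = ∑ j ∈ Finset.range (τ - τ / 2), q ^ j
        + ∑ j ∈ Finset.range (τ / 2), q ^ (τ - τ / 2 + j) := by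
      rw [← Finset.sum_range_add, show τ - τ / 2 + τ / 2 = τ by omega]
    rw [this, two_mul]
    gcongr
    calc ∑ j ∈ Finset.range (τ / 2), q ^ (τ - τ / 2 + j)
        ≤ ∑ j ∈ Finset.range (τ / 2), q ^ j :=
          Finset.sum_le_sum fun j _ => pow_le_pow_of_le_one hq0 hq1 (by omega)
      _ ≤ _ := Finset.sum_le_sum_of_subset_of_nonneg (Finset.range_mono (by omega))
          fun _ _ _ => by positivity
  have h5 : a * η * ∑ j ∈ Finset.range τ, q ^ j = 1 - q ^ τ := by
    have := mul_neg_geom_sum q τ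
    rw [← this, hq]
    ring
  have h6 : b * δ / (8 * a) * (1 - q ^ τ)
      ≤ η * b * (δ / 4) * ∑ j ∈ Finset.range (τ - τ / 2), q ^ j := by
    rw [← h5]
    have : b * δ / (8 * a) * (a * η * ∑ j ∈ Finset.range τ, q ^ j)
        = η * b * (δ / 8) * ∑ j ∈ Finset.range τ, q ^ j := by field_simp
    rw [this]
    have h7 : 0 ≤ η * b * (δ / 8) := by positivity
    nlinarith [mul_le_mul_of_nonneg_left h4 h7]
  linarith

/-- The bias of local SGD: averaging does not remove the drift of the mean caused by the bump. -/
theorem integral_localSGD_le (hK : 1 ≤ K) (hδ : 0 < δ) (ha : 0 < a) (hb : 0 ≤ b) (hab : 8 * b ≤ a)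
    (hη : 0 < η) (haη : a * η ≤ 1)
    (hs : 2 * δ ^ 2 ≤ (η * n) ^ 2 * ∑ j ∈ Finset.range (τ / 2), ((1 - a * η) ^ 2) ^ j) (ρ : ℕ) :
    ∫ ω, localSGD η τ (fun _ : Fin K => bumpGradient a b δ n) ω 0 ρ
        ∂(gaussianSamples (Fin K × ℕ × ℕ))
      ≤ -(b * δ / (8 * a) * (1 - (1 - a * η) ^ (τ * ρ))) := by
  induction ρ with
  | zero => simp [localSGD]
  | succ ρ ih =>
    have hU := memLp_localSGD (K := K) (η := η) (τ := τ) (a := a) (b := b) (n := n) hδ 0 ρ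
    have hround := fun k => integral_sgdIterate_le hδ ha hb hab hη haη hs hU k ρ
      fun i ω ξ => localSGD_update _ _ _ _ _ _ _
    have hq0 : 0 ≤ (1 - a * η) ^ τ := pow_nonneg (by linarith) _
    have hK0 : (0 : ℝ) < K := by exact_mod_cast hK
    simp only [localSGD, smul_eq_mul]
    rw [integral_const_mul, integral_finsetSum _ fun k _ =>
      (memLp_sgdIterate hδ hU k ρ τ).integrable (by norm_num)]
    calc (K : ℝ)⁻¹ * ∑ k : Fin K, _
        ≤ (K : ℝ)⁻¹ * ∑ k : Fin K, ((1 - a * η) ^ τ *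
          (-(b * δ / (8 * a) * (1 - (1 - a * η) ^ (τ * ρ))))
            - b * δ / (8 * a) * (1 - (1 - a * η) ^ τ)) := by
          gcongr with k
          refine (hround k).trans ?_
          gcongr
      -- With `Q = (1 - a * η) ^ τ` the drifts telescope: `Q * (1 - Q ^ ρ) + (1 - Q) = 1 - Q ^ (ρ +
      -- 1)`.
      _ = -(b * δ / (8 * a) * (1 - (1 - a * η) ^ (τ * (ρ + 1)))) := by
          rw [Finset.sum_const, Finset.card_univ, Fintype.card_fin, nsmul_eq_mul,
            inv_mul_cancel_left₀ hK0.ne', mul_add, pow_add, mul_one]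
          ring

/-- Linear dynamics written out over one round. -/
theorem sgdIterate_linear (ξ : ℕ → ℝ) (w : ℝ) (s : ℕ) :
    sgdIterate η (bumpGradient a 0 δ n) ξ w s
      = (1 - a * η) ^ s * w
        + ∑ i ∈ Finset.range s, -(η * n) * (1 - a * η) ^ (s - 1 - i) * ξ i := by
  induction s with
  | zero => simp [sgdIterate]
  | succ s ih =>
    simp only [sgdIterate, bumpGradient, smul_eq_mul, ih]
    rw [Finset.sum_range_succ]
    have : ∑ i ∈ Finset.range s, -(η * n) * (1 - a * η) ^ (s + 1 - 1 - i) * ξ i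
        = (1 - a * η) * ∑ i ∈ Finset.range s, -(η * n) * (1 - a * η) ^ (s - 1 - i) * ξ i := by
      rw [Finset.mul_sum]
      refine Finset.sum_congr rfl fun i hi => ?_
      rw [show s + 1 - 1 - i = s - 1 - i + 1 by have := Finset.mem_range.1 hi; omega, pow_succ]
      ring
    rw [this]
    simp only [add_tsub_cancel_right, tsub_self, pow_zero]
    ring

/-- The second moment of local SGD on a quadratic. -/
theorem integral_sq_localSGD_ge (hK : 1 ≤ K) (ρ : ℕ) :
    (η * n) ^ 2 / K * ∑ j ∈ Finset.range (τ * ρ), ((1 - a * η) ^ 2) ^ j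
      ≤ ∫ ω, localSGD η τ (fun _ : Fin K => bumpGradient a 0 1 n) ω 0 ρ ^ 2
        ∂(gaussianSamples (Fin K × ℕ × ℕ)) := by
  have hK0 : (0 : ℝ) < K := by exact_mod_cast hK
  induction ρ with
  | zero => simp [localSGD]
  | succ ρ ih =>
    have hU := memLp_localSGD (K := K) (η := η) (τ := τ) (a := a) (b := 0) (n := n) one_pos 0 ρ
    set q := 1 - a * η with hq
    set s : Finset (Fin K × ℕ × ℕ) := Finset.univ ×ˢ ({ρ} ×ˢ Finset.range τ) with hs
    set c : Fin K × ℕ × ℕ → ℝ := fun e => (K : ℝ)⁻¹ * (-(η * n) * q ^ (τ - 1 - e.2.2)) with hc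
    have hstep : ∀ ω : Fin K × ℕ × ℕ → ℝ,
        localSGD η τ (fun _ : Fin K => bumpGradient a 0 1 n) ω 0 (ρ + 1)
          = q ^ τ * localSGD η τ (fun _ : Fin K => bumpGradient a 0 1 n) ω 0 ρ
            + ∑ e ∈ s, c e * ω e := by
      intro ω
      simp only [localSGD, smul_eq_mul, sgdIterate_linear, hs, hc, hq, Finset.sum_product,
        Finset.sum_singleton, Finset.sum_add_distrib, mul_add, Finset.mul_sum]
      congr 1
      · rw [Finset.sum_const, Finset.card_univ, Fintype.card_fin, nsmul_eq_mul]
        field_simp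
      · refine Finset.sum_congr rfl fun k _ => Finset.sum_congr rfl fun i _ => ?_
        ring
    simp_rw [hstep]
    rw [integral_sq_add_sum_eval (hU.const_mul (q ^ τ)) c s]
    · simp_rw [mul_pow]
      rw [integral_const_mul]
      -- There are `K` nodes with squared weight `1 / K ^ 2` each: averaging divides the fresh
      -- variance by `K`.
      have hsum : ∑ e ∈ s, c e ^ 2 = (η * n) ^ 2 / K * ∑ j ∈ Finset.range τ, (q ^ 2) ^ j := by
        simp only [hs, hc, Finset.sum_product, Finset.sum_singleton]
        rw [Finset.sum_const, Finset.card_univ, Fintype.card_fin, nsmul_eq_mul,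
          ← Finset.sum_range_reflect (fun j => (q ^ 2) ^ j), Finset.mul_sum, Finset.mul_sum]
        refine Finset.sum_congr rfl fun i _ => ?_
        rw [mul_pow, mul_pow, neg_sq, pow_right_comm]
        field_simp
      rw [hsum, mul_add τ ρ 1, mul_one, add_comm (τ * ρ) τ, Finset.sum_range_add]
      have : ∑ j ∈ Finset.range (τ * ρ), (q ^ 2) ^ (τ + j)
          = (q ^ τ) ^ 2 * ∑ j ∈ Finset.range (τ * ρ), (q ^ 2) ^ j := by
        rw [Finset.mul_sum]
        refine Finset.sum_congr rfl fun j _ => ?_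
        rw [pow_add, pow_right_comm]
      rw [this]
      have h := mul_le_mul_of_nonneg_left ih (sq_nonneg (q ^ τ))
      rw [mul_pow] at h ⊢
      linarith
    · rintro ⟨k, ρ', i⟩ he ω ξ
      have : ρ' = ρ := by simp [hs] at he; exact he.2.symm
      subst this
      rw [localSGD_update]

/-- Without noise all nodes follow the same path, so averaging does nothing and the `τ * ρ` steps
compose. -/
theorem localSGD_noiseless (hK : 1 ≤ K) {Ξ : Type} (μ : ℝ) (ω : Fin K × ℕ × ℕ → Ξ) (w : ℝ)
    (ρ : ℕ) :
    localSGD η τ (fun (_ : Fin K) (x : ℝ) (_ : Ξ) => μ * x) ω w ρ = (1 - η * μ) ^ (τ * ρ) * w := by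
  have hK0 : (0 : ℝ) < K := by exact_mod_cast hK
  have h : ∀ (ξ : ℕ → Ξ) (x : ℝ) s,
      sgdIterate η (fun (x : ℝ) (_ : Ξ) => μ * x) ξ x s = (1 - η * μ) ^ s * x := by
    intro ξ x s
    induction s with
    | zero => simp [sgdIterate]
    | succ s ih => simp only [sgdIterate, ih, smul_eq_mul]; ring
  induction ρ with
  | zero => simp [localSGD]
  | succ ρ ih =>
    simp only [localSGD, h, ih, smul_eq_mul]
    rw [Finset.sum_const, Finset.card_univ, Fintype.card_fin, nsmul_eq_mul,
      inv_mul_cancel_left₀ hK0.ne', mul_add, pow_add, mul_one]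
    ring

end Rounds

/-- Local SGD on a separable problem acts on each coordinate separately. -/
theorem localSGD_map {V V' Ξ : Type} [AddCommGroup V] [Module ℝ V] [AddCommGroup V'] [Module ℝ V']
    {K : ℕ} (φ : V →ₗ[ℝ] V') (η : ℝ) (τ : ℕ) (g : Fin K → V → Ξ → V) (g' : Fin K → V' → Ξ → V')
    (h : ∀ k w ξ, φ (g k w ξ) = g' k (φ w) ξ) (ω : Fin K × ℕ × ℕ → Ξ) (w : V) (ρ : ℕ) :
    φ (localSGD η τ g ω w ρ) = localSGD η τ g' ω (φ w) ρ := by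
  have hs : ∀ k (ξ : ℕ → Ξ) (v : V) s,
      φ (sgdIterate η (g k) ξ v s) = sgdIterate η (g' k) ξ (φ v) s := by
    intro k ξ v s
    induction s with
    | zero => rfl
    | succ s ih => simp only [sgdIterate, map_sub, map_smul, h, ih]
  induction ρ with
  | zero => rfl
  | succ ρ ih => simp only [localSGD, map_smul, map_sum, hs, ih]

/-! ### The potential of the bumped gradient -/

/-- The potential of the bumped quadratic, whose derivative is `x ↦ a x + b (bump δ x)`. -/
noncomputable def bumpPotential (a b δ x : ℝ) : ℝ :=
  a / 2 * x ^ 2 + b * (δ * x - δ ^ 2 * Real.sin (x / δ))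

section Potential

variable {a b δ : ℝ}

theorem hasDerivAt_bumpPotential (x : ℝ) :
    HasDerivAt (bumpPotential a b δ) (a * x + b * bump δ x) x := by
  have h1 : HasDerivAt (fun x : ℝ => Real.sin (x / δ)) (Real.cos (x / δ) * (1 / δ)) x :=
    ((hasDerivAt_id x).div_const δ).sin
  have h2 := ((hasDerivAt_pow 2 x).const_mul (a / 2)).add
    ((((hasDerivAt_id x).const_mul δ).sub (h1.const_mul (δ ^ 2))).const_mul b)
  refine h2.congr_deriv ?_
  unfold bump
  field_simp
  push_cast
  ring

theorem abs_bumpGradient_sub_le (hδ : 0 < δ) (ha : 0 ≤ a) (hb : 0 ≤ b) (x y : ℝ) :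
    |(a * x + b * bump δ x) - (a * y + b * bump δ y)| ≤ (a + b) * |x - y| := by
  have h : (a * x + b * bump δ x) - (a * y + b * bump δ y)
      = a * (x - y) + b * (bump δ x - bump δ y) := by ring
  rw [h]
  refine (abs_add_le _ _).trans ?_
  rw [abs_mul, abs_mul, abs_of_nonneg ha, abs_of_nonneg hb, add_mul]
  exact add_le_add_right (mul_le_mul_of_nonneg_left (abs_bump_sub_le hδ x y) hb) _

theorem convexOn_bumpPotential (hδ : 0 < δ) (hb : 0 ≤ b) (hab : b ≤ a) :
    ConvexOn ℝ Set.univ (bumpPotential a b δ) := by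
  refine Monotone.convexOn_univ_of_deriv
    (fun x => (hasDerivAt_bumpPotential x).differentiableAt) fun x y hxy => ?_
  rw [(hasDerivAt_bumpPotential x).deriv, (hasDerivAt_bumpPotential y).deriv]
  have h := (abs_le.1 (abs_bump_sub_le hδ x y)).2
  rw [abs_of_nonpos (by linarith)] at h
  nlinarith

/-- By scaling this is `|t - sin t| ≤ t ^ 2 / 2`: for `0 ≤ t ≤ 3` it follows from the cubic bound,
beyond that from `t + 1 ≤ t ^ 2 / 2`, and by oddness for negative `t`. It traps the potential
between two quadratics. -/
theorem abs_sub_bump_le (hδ : 0 < δ) (x : ℝ) : |δ * x - δ ^ 2 * Real.sin (x / δ)| ≤ x ^ 2 / 2 := by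
  have key : ∀ t : ℝ, |t - Real.sin t| ≤ t ^ 2 / 2 := by
    have hpos : ∀ t : ℝ, 0 ≤ t → |t - Real.sin t| ≤ t ^ 2 / 2 := by
      intro t ht
      rw [abs_of_nonneg (by linarith [Real.sin_le ht])]
      rcases le_total t 3 with h | h
      · have h1 := abs_le.1 (Real.abs_sub_sin_le t)
        rw [abs_of_nonneg ht] at h1
        nlinarith [mul_nonneg (sq_nonneg t) (sub_nonneg.2 h)]
      · nlinarith [Real.neg_one_le_sin t]
    intro t
    rcases le_total 0 t with h | h
    · exact hpos t h
    · have := hpos (-t) (by linarith)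
      rwa [Real.sin_neg, neg_sq, ← abs_neg, show -(-t - -Real.sin t) = t - Real.sin t by ring]
        at this
  have h : δ * x - δ ^ 2 * Real.sin (x / δ) = δ ^ 2 * (x / δ - Real.sin (x / δ)) := by
    field_simp
  rw [h, abs_mul, abs_of_nonneg (sq_nonneg δ)]
  calc δ ^ 2 * |x / δ - Real.sin (x / δ)| ≤ δ ^ 2 * ((x / δ) ^ 2 / 2) := by gcongr; exact key _
    _ = x ^ 2 / 2 := by field_simp

theorem le_bumpPotential (hδ : 0 < δ) (hb : 0 ≤ b) (x : ℝ) :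
    (a - b) / 2 * x ^ 2 ≤ bumpPotential a b δ x := by
  have h := (abs_le.1 (abs_sub_bump_le hδ x)).1
  unfold bumpPotential
  nlinarith

theorem bumpPotential_le (hδ : 0 < δ) (hb : 0 ≤ b) (x : ℝ) :
    bumpPotential a b δ x ≤ (a + b) / 2 * x ^ 2 := by
  have h := (abs_le.1 (abs_sub_bump_le hδ x)).2
  unfold bumpPotential
  nlinarith

theorem contDiff_bumpPotential : ContDiff ℝ 2 (bumpPotential a b δ) := by
  unfold bumpPotential
  fun_prop

end Potential

/-! ### The hard function on `ℝ³` -/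

/-- The separable hard function on `ℝ³`: a bumped quadratic, a flat and a steep quadratic. -/
noncomputable def hardFunction (a b δ μ L : ℝ) (w : EuclideanSpace ℝ (Fin 3)) : ℝ :=
  bumpPotential a b δ (w 0) + μ / 2 * w 1 ^ 2 + L / 2 * w 2 ^ 2

/-- The gradient of the hard function with noise `n * ξ` in the first coordinate. -/
noncomputable def hardGradient (a b δ μ L n : ℝ) (w : EuclideanSpace ℝ (Fin 3)) (ξ : ℝ) :
    EuclideanSpace ℝ (Fin 3) :=
  !₂[bumpGradient a b δ n (w 0) ξ, μ * w 1, L * w 2]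

section HardFunction

variable {a b δ μ L n : ℝ}

theorem hasGradientAt_hardFunction (w : EuclideanSpace ℝ (Fin 3)) :
    HasGradientAt (hardFunction a b δ μ L) (hardGradient a b δ μ L n w 0) w := by
  rw [hasGradientAt_iff_hasFDerivAt]
  have hp : ∀ i : Fin 3, HasFDerivAt (fun v : EuclideanSpace ℝ (Fin 3) => v i)
      (EuclideanSpace.proj i : StrongDual ℝ (EuclideanSpace ℝ (Fin 3))) w :=
    fun i => (EuclideanSpace.proj i : StrongDual ℝ (EuclideanSpace ℝ (Fin 3))).hasFDerivAt
  have h0 := (hasDerivAt_bumpPotential (a := a) (b := b) (δ := δ) (w 0)).comp_hasFDerivAt w (hp 0)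
  have h1 := ((hp 1).pow 2).const_mul (μ / 2)
  have h2 := ((hp 2).pow 2).const_mul (L / 2)
  refine ((h0.add h1).add h2).congr_fderiv ?_
  ext v
  simp [hardGradient, bumpGradient, InnerProductSpace.toDual_apply_apply, PiLp.inner_apply,
    Fin.sum_univ_three]
  ring

theorem norm_hardGradient_sub_le (hδ : 0 < δ) (ha : 0 ≤ a) (hb : 0 ≤ b) (hab : a + b ≤ L)
    (hμ : 0 ≤ μ) (hμL : μ ≤ L) (v w : EuclideanSpace ℝ (Fin 3)) :
    ‖hardGradient a b δ μ L n v 0 - hardGradient a b δ μ L n w 0‖ ≤ L * ‖v - w‖ := by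
  have hL : 0 ≤ L := hμ.trans hμL
  refine abs_le_of_sq_le_sq' ?_ (by positivity) |>.2
  rw [mul_pow, EuclideanSpace.real_norm_sq_eq, EuclideanSpace.real_norm_sq_eq,
    Fin.sum_univ_three, Fin.sum_univ_three]
  simp only [hardGradient, bumpGradient, mul_zero, add_zero, PiLp.sub_apply]
  simp only [Matrix.cons_val_zero, Matrix.cons_val_one, Matrix.cons_val]
  have h0 := (abs_bumpGradient_sub_le hδ ha hb (v 0) (w 0)).trans
    (mul_le_mul_of_nonneg_right hab (abs_nonneg _))
  have h0' : (a * v 0 + b * bump δ (v 0) - (a * w 0 + b * bump δ (w 0))) ^ 2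
      ≤ L ^ 2 * (v 0 - w 0) ^ 2 := by
    rw [← sq_abs, ← sq_abs (v 0 - w 0), ← mul_pow]
    gcongr
  have h1 : (μ * v 1 - μ * w 1) ^ 2 ≤ L ^ 2 * (v 1 - w 1) ^ 2 := by
    rw [← mul_sub, mul_pow]
    gcongr
  linarith

theorem convexOn_hardFunction (hδ : 0 < δ) (hb : 0 ≤ b) (hab : b ≤ a) (hμ : 0 ≤ μ) (hL : 0 ≤ L) :
    ConvexOn ℝ Set.univ (hardFunction a b δ μ L) := by
  have hp : ∀ i : Fin 3, ∀ f : ℝ → ℝ, ConvexOn ℝ Set.univ f →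
      ConvexOn ℝ Set.univ (fun v : EuclideanSpace ℝ (Fin 3) => f (v i)) := fun i f hf =>
    hf.comp_linearMap
      (EuclideanSpace.proj i : StrongDual ℝ (EuclideanSpace ℝ (Fin 3))).toLinearMap
  have hsq : ∀ c : ℝ, 0 ≤ c → ConvexOn ℝ Set.univ fun x : ℝ => c / 2 * x ^ 2 := fun c hc =>
    (even_two.convexOn_pow).smul (by positivity : 0 ≤ c / 2)
  exact ((hp 0 _ (convexOn_bumpPotential hδ hb hab)).add (hp 1 _ (hsq μ hμ))).add
    (hp 2 _ (hsq L hL))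

theorem contDiff_hardFunction : ContDiff ℝ 2 (hardFunction a b δ μ L) := by
  have hp : ∀ i : Fin 3, ContDiff ℝ 2 (fun v : EuclideanSpace ℝ (Fin 3) => v i) :=
    fun i => (EuclideanSpace.proj i : StrongDual ℝ (EuclideanSpace ℝ (Fin 3))).contDiff
  exact ((contDiff_bumpPotential.comp (hp 0)).add (contDiff_const.mul ((hp 1).pow 2))).add
    (contDiff_const.mul ((hp 2).pow 2))

theorem hardFunction_nonneg (hδ : 0 < δ) (hb : 0 ≤ b) (hab : b ≤ a) (hμ : 0 ≤ μ) (hL : 0 ≤ L)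
    (w : EuclideanSpace ℝ (Fin 3)) : 0 ≤ hardFunction a b δ μ L w := by
  have h := le_bumpPotential (a := a) hδ hb (w 0)
  have : 0 ≤ (a - b) / 2 * w 0 ^ 2 := mul_nonneg (by linarith) (sq_nonneg _)
  unfold hardFunction
  have : 0 ≤ bumpPotential a b δ (w 0) := by linarith
  positivity

theorem hardFunction_zero : hardFunction a b δ μ L 0 = 0 := by
  simp [hardFunction, bumpPotential]

end HardFunction

/-! ### Exact density ratio estimation on two features -/

section RatioEstimation

/-- Probability of the feature `i` given the label `y`. -/
noncomputable def likelihood (i y : Fin 2) : ℝ := if i = y then 2 / 3 else 1 / 3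

theorem likelihood_pos (i y : Fin 2) : 0 < likelihood i y := by
  unfold likelihood; split_ifs <;> norm_num

/-- The two features `0` and `1` on the line. -/
noncomputable def featurePoint (i : Fin 2) : EuclideanSpace ℝ (Fin 1) :=
  EuclideanSpace.single 0 ((i : ℕ) : ℝ)

theorem featurePoint_apply (i : Fin 2) : featurePoint i 0 = ((i : ℕ) : ℝ) := by
  simp [featurePoint]

/-- The class-conditional distributions on the two features. -/
noncomputable def featureLaw (y : Fin 2) : Measure (EuclideanSpace ℝ (Fin 1)) :=
  ∑ i, ENNReal.ofReal (likelihood i y) • Measure.dirac (featurePoint i)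

theorem isProbabilityMeasure_featureLaw (y : Fin 2) : IsProbabilityMeasure (featureLaw y) := by
  refine ⟨?_⟩
  simp only [featureLaw, Fin.sum_univ_two, Measure.add_apply, Measure.smul_apply, measure_univ,
    smul_eq_mul, mul_one]
  rw [← ENNReal.ofReal_add (likelihood_pos _ _).le (likelihood_pos _ _).le]
  fin_cases y <;> norm_num [likelihood]

theorem featureLaw_compl (y : Fin 2) : featureLaw y (Set.range featurePoint)ᶜ = 0 := by
  have hm : MeasurableSet (Set.range featurePoint)ᶜ := (Set.finite_range _).measurableSet.compl
  simp [featureLaw, Measure.dirac_apply' _ hm]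

theorem featurePoint_mem_support (i y : Fin 2) : featurePoint i ∈ (featureLaw y).support := by
  rw [Measure.mem_support_iff_forall]
  intro U hU
  have h1 : ENNReal.ofReal (likelihood i y) • Measure.dirac (featurePoint i) ≤ featureLaw y :=
    Finset.single_le_sum (f := fun i => ENNReal.ofReal (likelihood i y) •
      Measure.dirac (featurePoint i)) (fun _ _ => Measure.zero_le _) (Finset.mem_univ i)
  refine lt_of_lt_of_le ?_ (h1 U)
  have h2 : (1 : ENNReal) ≤ Measure.dirac (featurePoint i) U := by
    have := Measure.le_dirac_apply (s := U) (a := featurePoint i)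
    rwa [Set.indicator_of_mem (mem_of_mem_nhds hU), Pi.one_apply] at this
  simp only [Measure.smul_apply, smul_eq_mul]
  exact ENNReal.mul_pos (by simpa using likelihood_pos i y) (by positivity)

/-- Logits of the Bayes predictor for the label distribution `q`. -/
noncomputable def bayesLogits (q : Fin 2 → ℝ) (x : EuclideanSpace ℝ (Fin 1)) (y : Fin 2) : ℝ :=
  open Classical in Real.log (q y * likelihood (if x 0 = 0 then 0 else 1) y)

theorem bayesLogits_featurePoint (q : Fin 2 → ℝ) (i y : Fin 2) :
    bayesLogits q (featurePoint i) y = Real.log (q y * likelihood i y) := by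
  unfold bayesLogits
  congr 3
  rw [featurePoint_apply]
  fin_cases i <;> simp

variable {q : Fin 2 → ℝ}

/-- The softmax of these logits is the Bayes posterior, here with its normalising constant pulled
out; that constant does not depend on `r` and so does not affect the maximiser. -/
theorem sum_softmax_bayesLogits (hq : ∀ y, 0 < q y) (i : Fin 2) (r : Fin 2 → ℝ) :
    ∑ y, softmax (bayesLogits q (featurePoint i)) y * r y
      = (∑ y, likelihood i y * (r y * q y)) / ∑ y, q y * likelihood i y := by
  have h : ∀ y, Real.exp (bayesLogits q (featurePoint i) y) = q y * likelihood i y := fun y => by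
    rw [bayesLogits_featurePoint, Real.exp_log (mul_pos (hq y) (likelihood_pos i y))]
  simp only [softmax, h, Finset.sum_div]
  refine Finset.sum_congr rfl fun y _ => ?_
  ring

/-- On the balanced test sample the Bayes predictor has a unique ratio estimate, the exact one. -/
theorem isRatioEstimate_bayes_iff (hq : ∀ y, 0 < q y) (r : Fin 2 → ℝ) :
    IsRatioEstimate q (bayesLogits q) featurePoint r ↔ r = fun y => 1 / 2 / q y := by
  have hZ : ∀ i, 0 < ∑ y, q y * likelihood i y := fun i => by
    rw [Fin.sum_univ_two]
    have := mul_pos (hq 0) (likelihood_pos i 0)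
    have := mul_pos (hq 1) (likelihood_pos i 1)
    positivity
  set C : ℝ := Real.log (∑ y, q y * likelihood 0 y) + Real.log (∑ y, q y * likelihood 1 y) with hC
  -- The constraint leaves one free variable `t = r 0 * q 0`, and the mean log-likelihood is a
  -- monotone function of `(1 + t) * (2 - t)`, maximal only at `t = 1 / 2`.
  have hobj : ∀ r ∈ ratioSet q, 0 < 1 / 3 + r 0 * q 0 / 3 ∧ 0 < 2 / 3 - r 0 * q 0 / 3 ∧
      ((2 : ℕ) : ℝ)⁻¹ * ∑ i, Real.log (∑ y, softmax (bayesLogits q (featurePoint i)) y * r y)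
        = (Real.log ((1 / 3 + r 0 * q 0 / 3) * (2 / 3 - r 0 * q 0 / 3)) - C) / 2 := by
    rintro r ⟨h0, h1⟩
    rw [Fin.sum_univ_two] at h1
    have ha := mul_nonneg (h0 0) (hq 0).le
    have hb := mul_nonneg (h0 1) (hq 1).le
    have hA : 0 < 1 / 3 + r 0 * q 0 / 3 := by linarith
    have hB : 0 < 2 / 3 - r 0 * q 0 / 3 := by linarith
    refine ⟨hA, hB, ?_⟩
    simp only [sum_softmax_bayesLogits hq]
    rw [Fin.sum_univ_two (f := fun i : Fin 2 => Real.log _)]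
    have e0 : ∑ y, likelihood 0 y * (r y * q y) = 1 / 3 + r 0 * q 0 / 3 := by
      rw [Fin.sum_univ_two]; simp [likelihood]; linarith
    have e1 : ∑ y, likelihood 1 y * (r y * q y) = 2 / 3 - r 0 * q 0 / 3 := by
      rw [Fin.sum_univ_two]; simp [likelihood]; linarith
    rw [e0, e1, Real.log_div hA.ne' (hZ 0).ne', Real.log_div hB.ne' (hZ 1).ne',
      Real.log_mul hA.ne' hB.ne', hC]
    push_cast
    ring
  have hmem : (fun y => 1 / 2 / q y) ∈ ratioSet q := by
    refine ⟨fun y => by have := hq y; positivity, ?_⟩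
    rw [Fin.sum_univ_two, div_mul_cancel₀ _ (hq 0).ne', div_mul_cancel₀ _ (hq 1).ne']
    norm_num
  have hval : ((1 / 3 : ℝ) + 1 / 2 / q 0 * q 0 / 3) * (2 / 3 - 1 / 2 / q 0 * q 0 / 3) = 1 / 4 := by
    rw [div_mul_cancel₀ _ (hq 0).ne']; norm_num
  constructor
  · rintro ⟨hr, hmax⟩
    obtain ⟨hA, hB, hO⟩ := hobj r hr
    have h := hmax hmem
    simp only [Set.mem_ofPred_eq] at h
    rw [hO, (hobj _ hmem).2.2, hval] at h
    have h' : Real.log (1 / 4) ≤ Real.log ((1 / 3 + r 0 * q 0 / 3) * (2 / 3 - r 0 * q 0 / 3)) := by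
      linarith
    rw [Real.log_le_log_iff (by norm_num) (mul_pos hA hB)] at h'
    have h0 : r 0 * q 0 = 1 / 2 := by nlinarith [sq_nonneg (r 0 * q 0 - 1 / 2)]
    have h1 : r 1 * q 1 = 1 / 2 := by
      have := hr.2
      rw [Fin.sum_univ_two] at this
      linarith
    funext y
    rw [eq_div_iff (hq y).ne']
    fin_cases y
    · exact h0
    · exact h1
  · rintro rfl
    refine ⟨hmem, fun r hr => ?_⟩
    obtain ⟨hA, hB, hO⟩ := hobj r hr
    simp only [Set.mem_ofPred_eq]
    rw [hO, (hobj _ hmem).2.2, hval]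
    have := Real.log_le_log (mul_pos hA hB)
      (by nlinarith [sq_nonneg (r 0 * q 0 - 1 / 2)] :
        (1 / 3 + r 0 * q 0 / 3) * (2 / 3 - r 0 * q 0 / 3) ≤ 1 / 4)
    linarith

end RatioEstimation

/-! ### The label shift problem -/

/-- Training label distribution for which the aggregated ratio of the label `0` is `rmax`. -/
noncomputable def trainingLaw (K : ℕ) (rmax : ℝ) (y : Fin 2) : ℝ :=
  if y = 0 then K / (2 * rmax) else 1 - K / (2 * rmax)

section Problem

variable {K : ℕ} {rmax : ℝ}

theorem trainingLaw_pos (hK : 1 ≤ K) (hr : (K : ℝ) ≤ rmax) (y : Fin 2) :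
    0 < trainingLaw K rmax y := by
  have hK0 : (0 : ℝ) < K := by exact_mod_cast hK
  have hr0 : 0 < rmax := hK0.trans_le hr
  unfold trainingLaw
  split_ifs
  · positivity
  · rw [sub_pos, div_lt_one (by positivity)]
    linarith

/-- A label shift problem with exact ratio estimates whose loss is the given function `Φ`. -/
noncomputable def labelShiftProblem (K : ℕ) (rmax : ℝ) (hK : 1 ≤ K) (hr : (K : ℝ) ≤ rmax)
    (Φ : EuclideanSpace ℝ (Fin 3) → ℝ) (hΦ : ∀ z, 0 ≤ Φ z) : IWERMProblem K where
  d₀ := 1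
  m := 2
  p := 3
  d := 3
  X := Set.range featurePoint
  isCompact_X := (Set.finite_range _).isCompact
  classCond := featureLaw
  isProbabilityMeasure_classCond := isProbabilityMeasure_featureLaw
  classCond_compl := featureLaw_compl
  pTr _ := trainingLaw K rmax
  pTr_pos _ := trainingLaw_pos hK hr
  pTr_sum _ := by simp [Fin.sum_univ_two, trainingLaw]
  pTe _ _ := 1 / 2
  pTe_nonneg _ _ := by norm_num
  pTe_sum _ := by simp
  -- The single training sample has label `0`, the one of weight `rmax`, so the local objective is
  -- `rmax * Φ`.
  nTr _ := 1
  nTr_pos _ := one_pos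
  nTe _ := 2
  nTe_pos _ := two_pos
  xTr _ _ := featurePoint 0
  yTr _ _ := 0
  xTr_mem _ _ := ⟨Set.mem_range_self 0, featurePoint_mem_support 0 0⟩
  xTe _ := featurePoint
  xTe_mem _ i := ⟨0, by norm_num, Set.mem_range_self i, featurePoint_mem_support i 0⟩
  -- With a one-element predictor class the training condition is automatic.
  Θ := Unit
  logits _ := bayesLogits (trainingLaw K rmax)
  ζ := 1
  ζ_pos := one_pos
  θ _ := ()
  isMinOn_θ _ := isMinOn_const
  rHat _ _ y := 1 / 2 / trainingLaw K rmax y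
  isRatioEstimate_rHat _ _ := (isRatioEstimate_bayes_iff (trainingLaw_pos hK hr) _).2 rfl
  -- The hypothesis returns the parameter itself, so the loss can be any nonnegative function of
  -- `w`.
  h w _ := w
  ℓ z _ := Φ z
  ℓ_nonneg z _ := hΦ z

variable {hK : 1 ≤ K} {hr : (K : ℝ) ≤ rmax} {Φ : EuclideanSpace ℝ (Fin 3) → ℝ}
  {hΦ : ∀ z, 0 ≤ Φ z}

theorem labelShiftProblem_weight_zero (k : Fin K) :
    (labelShiftProblem K rmax hK hr Φ hΦ).weight k (0 : Fin 2) = rmax := by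
  have hK0 : (0 : ℝ) < K := by exact_mod_cast hK
  have hr0 : 0 < rmax := hK0.trans_le hr
  change ∑ _j : Fin K, 1 / 2 / trainingLaw K rmax 0 = rmax
  simp only [trainingLaw, if_true, Finset.sum_const, Finset.card_univ, Fintype.card_fin,
    nsmul_eq_mul]
  field_simp

theorem labelShiftProblem_weight_eq_trueRatio (k : Fin K)
    (y : Fin (labelShiftProblem K rmax hK hr Φ hΦ).m) :
    (labelShiftProblem K rmax hK hr Φ hΦ).weight k y
      = (labelShiftProblem K rmax hK hr Φ hΦ).trueRatio k y := by
  change ∑ _j : Fin K, 1 / 2 / trainingLaw K rmax y = (∑ _j : Fin K, 1 / 2) / trainingLaw K rmax y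
  rw [Finset.sum_div]

/-- Uniqueness of the ratio estimate leaves only the values `K / (2 * q y)`, `q` being the training
law; label `0` gives `rmax`, and label `1` gives less or the same because `K ≤ rmax` makes `q 0 ≤ 1
/ 2`. -/
theorem isLUB_labelShiftProblem_ratioValues :
    IsLUB (labelShiftProblem K rmax hK hr Φ hΦ).ratioValues rmax := by
  have hK0 : (0 : ℝ) < K := by exact_mod_cast hK
  have hr0 : 0 < rmax := hK0.trans_le hr
  refine IsGreatest.isLUB ⟨?_, ?_⟩
  · refine ⟨⟨0, hK⟩, (), (0 : Fin 2), _,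
      (labelShiftProblem K rmax hK hr Φ hΦ).isRatioEstimate_rHat ⟨0, hK⟩, ?_⟩
    exact (labelShiftProblem_weight_zero (hK := hK) (hr := hr) (hΦ := hΦ) ⟨0, hK⟩).symm
  · rintro v ⟨k, t, y, r, h, rfl⟩
    have h' : ∀ j, r j = fun y => 1 / 2 / trainingLaw K rmax y := fun j =>
      (isRatioEstimate_bayes_iff (trainingLaw_pos hK hr) _).1 (h j)
    simp only [h']
    rw [Finset.sum_const, Finset.card_univ, Fintype.card_fin, nsmul_eq_mul, ← mul_div_assoc,
      div_le_iff₀ (trainingLaw_pos hK hr y)]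
    have hx : rmax * (K / (2 * rmax)) = K / 2 := by field_simp
    unfold trainingLaw
    split_ifs
    · linarith
    · rw [mul_sub, hx]; linarith

theorem labelShiftProblem_localObjective (k : Fin K) (w : EuclideanSpace ℝ (Fin 3)) :
    (labelShiftProblem K rmax hK hr Φ hΦ).localObjective k w = rmax * Φ w := by
  change ((1 : ℕ) : ℝ)⁻¹ * ∑ _i : Fin 1,
    (labelShiftProblem K rmax hK hr Φ hΦ).weight k (0 : Fin 2) * Φ w = rmax * Φ w
  rw [labelShiftProblem_weight_zero]
  simp

theorem labelShiftProblem_objective (w : EuclideanSpace ℝ (Fin 3)) :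
    (labelShiftProblem K rmax hK hr Φ hΦ).objective w = rmax * Φ w := by
  have hK0 : (0 : ℝ) < K := by exact_mod_cast hK
  unfold IWERMProblem.objective
  simp only [labelShiftProblem_localObjective]
  rw [Finset.sum_const, Finset.card_univ, Fintype.card_fin, nsmul_eq_mul,
    inv_mul_cancel_left₀ hK0.ne']

end Problem

/-! ### The stochastic gradient of the hard function -/

section StochasticGradient

variable {a b δ μ L n : ℝ}

theorem hardGradient_eq_add_smul (w : EuclideanSpace ℝ (Fin 3)) (ξ : ℝ) :
    hardGradient a b δ μ L n w ξ
      = hardGradient a b δ μ L n w 0 + ξ • EuclideanSpace.single (0 : Fin 3) n := by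
  ext i
  fin_cases i <;> simp [hardGradient, bumpGradient, mul_comm]

theorem measurable_hardGradient :
    Measurable (Function.uncurry (hardGradient a b δ μ L n)) := by
  have hp : ∀ i : Fin 3, Measurable (fun v : EuclideanSpace ℝ (Fin 3) × ℝ => v.1 i) := fun i =>
    ((EuclideanSpace.proj i : StrongDual ℝ (EuclideanSpace ℝ (Fin 3))).continuous.comp
      continuous_fst).measurable
  refine (WithLp.measurable_toLp 2 (Fin 3 → ℝ)).comp (measurable_pi_iff.2 fun i => ?_)
  fin_cases i
  · exact (((hp 0).const_mul a).add (((continuous_bump δ).measurable.comp (hp 0)).const_mul b)).add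
      (measurable_snd.const_mul n)
  · exact (hp 1).const_mul μ
  · exact (hp 2).const_mul L

theorem memLp_hardGradient (w : EuclideanSpace ℝ (Fin 3)) :
    MemLp (hardGradient a b δ μ L n w) 2 (gaussianReal 0 1) := by
  have h : MemLp (fun ξ : ℝ => ξ) 2 (gaussianReal 0 1) := memLp_id_gaussianReal' 2 (by norm_num)
  have h1 : ∀ v : EuclideanSpace ℝ (Fin 3), MemLp (fun ξ : ℝ => ξ • v) 2 (gaussianReal 0 1) := by
    intro v
    refine (h.norm.const_mul ‖v‖).of_le (by fun_prop) (.of_forall fun ξ => ?_)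
    rw [norm_smul, norm_mul, norm_norm, norm_norm, mul_comm]
  have h2 : MemLp (fun _ : ℝ => hardGradient a b δ μ L n w 0) 2 (gaussianReal 0 1) := memLp_const _
  exact (h2.add (h1 _)).ae_eq (.of_forall fun ξ => (hardGradient_eq_add_smul w ξ).symm)

theorem integral_hardGradient (w : EuclideanSpace ℝ (Fin 3)) :
    ∫ ξ, hardGradient a b δ μ L n w ξ ∂(gaussianReal 0 1) = hardGradient a b δ μ L n w 0 := by
  rw [integral_congr_ae (.of_forall (hardGradient_eq_add_smul w))]
  have h : Integrable (fun ξ : ℝ => ξ) (gaussianReal 0 1) :=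
    (memLp_id_gaussianReal' 2 (by norm_num)).integrable (by norm_num)
  rw [integral_add (integrable_const _) (h.smul_const _), integral_smul_const,
    integral_id_gaussianReal]
  simp

theorem variance_hardGradient_le {σ : ℝ} (hn : 0 ≤ n) (hnσ : n ≤ σ)
    (w : EuclideanSpace ℝ (Fin 3)) :
    ∫ ξ, ‖hardGradient a b δ μ L n w ξ - hardGradient a b δ μ L n w 0‖ ^ 2 ∂(gaussianReal 0 1)
      ≤ σ ^ 2 := by
  have h : ∀ ξ : ℝ, ‖hardGradient a b δ μ L n w ξ - hardGradient a b δ μ L n w 0‖ ^ 2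
      = n ^ 2 * ξ ^ 2 := by
    intro ξ
    rw [hardGradient_eq_add_smul, add_sub_cancel_left, norm_smul, mul_pow]
    simp [mul_comm]
  simp_rw [h]
  rw [integral_const_mul, integral_sq_gaussianReal, mul_one]
  gcongr

theorem hardFunction_div_mul {r : ℝ} (hr : 0 < r) (w : EuclideanSpace ℝ (Fin 3)) :
    r * hardFunction (a / r) (b / r) δ (μ / r) (L / r) w = hardFunction a b δ μ L w := by
  unfold hardFunction bumpPotential
  field_simp

end StochasticGradient

/-! ### Reduction of the problem to the three coordinates -/

/-- A lower bound for local SGD on the hard function with smoothness `rmax * β` yields a label shift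
problem with the same lower bound. -/
theorem exists_problem_of_le {K τ R : ℕ} {rmax β D σ a b δ μ n y z v : ℝ} (hK : 1 ≤ K)
    (hr : (K : ℝ) ≤ rmax) (hβ : 0 < β) (hδ : 0 < δ) (hb : 0 ≤ b) (hba : b ≤ a)
    (hab : a + b ≤ rmax * β) (hμ : 0 ≤ μ) (hμL : μ ≤ rmax * β) (hn : 0 ≤ n) (hnσ : n ≤ σ)
    (hyz : ‖(!₂[0, y, z] : EuclideanSpace ℝ (Fin 3))‖ = D)
    (hv : ∀ η : ℝ, 0 < η → v ≤ ∫ ω, hardFunction a b δ μ (rmax * β)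
      (localSGD η τ (fun _ : Fin K => hardGradient a b δ μ (rmax * β) n) ω !₂[0, y, z] R)
        ∂(gaussianSamples (Fin K × ℕ × ℕ))) :
    ∃ (I : IWERMProblem K) (G : I.StochasticGradient σ) (w₀ wStar : I.W),
      IsLUB I.ratioValues rmax ∧
      (∀ k y, I.weight k y = I.trueRatio k y) ∧
      I.ConvexSmoothC2 β ∧
      (∀ k k', I.localObjective k = I.localObjective k') ∧
      IsMinOn I.objective Set.univ wStar ∧
      ‖w₀ - wStar‖ = D ∧
      ∀ η : ℝ, 0 < η → v ≤ expectedSuboptimality G η τ R w₀ wStar := by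
  have hK0 : (0 : ℝ) < K := by exact_mod_cast hK
  have hr0 : 0 < rmax := hK0.trans_le hr
  have ha : 0 ≤ a := hb.trans hba
  have hL : 0 ≤ rmax * β := by positivity
  have hba' : b / rmax ≤ a / rmax := by gcongr
  have hab' : a / rmax + b / rmax ≤ β := by rw [← add_div, div_le_iff₀ hr0]; linarith
  have hμL' : μ / rmax ≤ β := by rw [div_le_iff₀ hr0]; linarith
  have hβ' : rmax * β / rmax = β := by field_simp
  -- The coefficients, but not `δ`, are divided by `rmax`: the loss is `β`-smooth, and the
  -- importance weight restores the original function.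
  set Φ := hardFunction (a / rmax) (b / rmax) δ (μ / rmax) β with hΦdef
  have hΦ : ∀ w, 0 ≤ Φ w :=
    hardFunction_nonneg hδ (by positivity) hba' (by positivity) hβ.le
  have hscale : ∀ w, rmax * Φ w = hardFunction a b δ μ (rmax * β) w := by
    intro w
    rw [← hardFunction_div_mul hr0, hβ']
  set I := labelShiftProblem K rmax hK hr Φ hΦ with hI
  have hloc : ∀ k : Fin K, I.localObjective k = hardFunction a b δ μ (rmax * β) := by
    intro k
    funext w
    exact (labelShiftProblem_localObjective k w).trans (hscale w)
  have hobj : I.objective = hardFunction a b δ μ (rmax * β) := by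
    funext w
    exact (labelShiftProblem_objective w).trans (hscale w)
  have hgrad : ∀ (k : Fin K) (w : EuclideanSpace ℝ (Fin 3)),
      gradient (I.localObjective k) w = hardGradient a b δ μ (rmax * β) n w 0 := by
    intro k w
    rw [hloc]
    exact (hasGradientAt_hardFunction w).gradient
  let G : I.StochasticGradient σ :=
    { Ξ := ℝ
      ν := gaussianReal 0 1
      g := fun _ => hardGradient a b δ μ (rmax * β) n
      measurable_g := fun _ => measurable_hardGradient
      memLp_g := fun _ w => memLp_hardGradient w
      unbiased := fun k w => (integral_hardGradient w).trans (hgrad k w).symm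
      variance_le := fun k w => by
        rw [hgrad k w]
        exact variance_hardGradient_le hn hnσ w }
  refine ⟨I, G, (!₂[0, y, z] : EuclideanSpace ℝ (Fin 3)), (0 : EuclideanSpace ℝ (Fin 3)),
    isLUB_labelShiftProblem_ratioValues, labelShiftProblem_weight_eq_trueRatio, ?_, ?_, ?_, ?_, ?_⟩
  · intro x _ _
    refine ⟨convexOn_hardFunction hδ (by positivity) hba' (by positivity) hβ.le,
      contDiff_hardFunction, fun v w => ?_⟩
    have h := norm_hardGradient_sub_le (n := 0) hδ (by positivity : 0 ≤ a / rmax)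
      (by positivity : 0 ≤ b / rmax) hab' (by positivity) hμL' v w
    rwa [← (hasGradientAt_hardFunction v).gradient, ← (hasGradientAt_hardFunction w).gradient] at h
  · intro k k'
    rw [hloc, hloc]
  · rw [hobj]
    intro w _
    change hardFunction a b δ μ (rmax * β) 0 ≤ hardFunction a b δ μ (rmax * β) w
    rw [hardFunction_zero]
    exact hardFunction_nonneg hδ hb hba hμ hL w
  · refine Eq.trans ?_ hyz
    congr 1
    exact sub_zero _
  · intro η hη
    refine (hv η hη).trans (le_of_eq ?_)
    unfold expectedSuboptimality
    rw [hobj]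
    refine integral_congr_ae (.of_forall fun ω => ?_)
    change _ = hardFunction a b δ μ (rmax * β)
      (localSGD η τ (fun _ : Fin K => hardGradient a b δ μ (rmax * β) n) ω !₂[0, y, z] R)
      - hardFunction a b δ μ (rmax * β) 0
    rw [hardFunction_zero, sub_zero]

/-- The expected value of the hard function splits over the coordinates. -/
theorem integral_hardFunction_localSGD_ge {K τ R : ℕ} {a b δ μ L n η y z : ℝ} (hK : 1 ≤ K)
    (hδ : 0 < δ) (hb : 0 ≤ b) :
    (a - b) / 2 * (∫ ω, localSGD η τ (fun _ : Fin K => bumpGradient a b δ n) ω 0 R ^ 2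
        ∂(gaussianSamples (Fin K × ℕ × ℕ)))
      + μ / 2 * ((1 - η * μ) ^ (τ * R) * y) ^ 2 + L / 2 * ((1 - η * L) ^ (τ * R) * z) ^ 2
    ≤ ∫ ω, hardFunction a b δ μ L
      (localSGD η τ (fun _ : Fin K => hardGradient a b δ μ L n) ω !₂[0, y, z] R)
        ∂(gaussianSamples (Fin K × ℕ × ℕ)) := by
  set U := fun ω : Fin K × ℕ × ℕ → ℝ =>
    localSGD η τ (fun _ : Fin K => bumpGradient a b δ n) ω 0 R with hUdef
  have hU : MemLp U 2 (gaussianSamples (Fin K × ℕ × ℕ)) := memLp_localSGD hδ 0 R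
  let p : Fin 3 → EuclideanSpace ℝ (Fin 3) →ₗ[ℝ] ℝ := fun i =>
    (EuclideanSpace.proj i : StrongDual ℝ (EuclideanSpace ℝ (Fin 3))).toLinearMap
  have hsplit : ∀ ω : Fin K × ℕ × ℕ → ℝ, hardFunction a b δ μ L
      (localSGD η τ (fun _ : Fin K => hardGradient a b δ μ L n) ω !₂[0, y, z] R)
      = bumpPotential a b δ (U ω) + (μ / 2 * ((1 - η * μ) ^ (τ * R) * y) ^ 2
        + L / 2 * ((1 - η * L) ^ (τ * R) * z) ^ 2) := by
    -- Each coordinate of the gradient depends only on that coordinate and the sample, so the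
    -- projections commute with the iteration.
    intro ω
    have h0 := localSGD_map (p 0) η τ (fun _ : Fin K => hardGradient a b δ μ L n)
      (fun _ => bumpGradient a b δ n) (fun _ _ _ => rfl) ω !₂[0, y, z] R
    have h1 := localSGD_map (p 1) η τ (fun _ : Fin K => hardGradient a b δ μ L n)
      (fun _ x _ => μ * x) (fun _ _ _ => rfl) ω !₂[0, y, z] R
    have h2 := localSGD_map (p 2) η τ (fun _ : Fin K => hardGradient a b δ μ L n)
      (fun _ x _ => L * x) (fun _ _ _ => rfl) ω !₂[0, y, z] R
    rw [localSGD_noiseless hK] at h1 h2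
    change (localSGD η τ (fun _ : Fin K => hardGradient a b δ μ L n) ω !₂[0, y, z] R) 0 = U ω at h0
    change (localSGD η τ (fun _ : Fin K => hardGradient a b δ μ L n) ω !₂[0, y, z] R) 1
      = (1 - η * μ) ^ (τ * R) * y at h1
    change (localSGD η τ (fun _ : Fin K => hardGradient a b δ μ L n) ω !₂[0, y, z] R) 2
      = (1 - η * L) ^ (τ * R) * z at h2
    unfold hardFunction
    rw [h0, h1, h2, add_assoc]
  have hi : Integrable (fun ω => bumpPotential a b δ (U ω)) (gaussianSamples (Fin K × ℕ × ℕ)) := by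
    refine Integrable.mono' (hU.integrable_sq.const_mul ((|a| + b) / 2))
      ((contDiff_bumpPotential.continuous).comp_aestronglyMeasurable hU.1)
      (.of_forall fun ω => ?_)
    have h1 := le_bumpPotential (a := a) hδ hb (U ω)
    have h2 := bumpPotential_le (a := a) hδ hb (U ω)
    rw [Real.norm_eq_abs, abs_le]
    constructor <;> nlinarith [sq_nonneg (U ω), neg_abs_le a, le_abs_self a]
  simp_rw [hsplit]
  rw [integral_add hi (integrable_const _), ← integral_const_mul, add_assoc]
  simp only [integral_const, probReal_univ, smul_eq_mul, one_mul]
  exact add_le_add (integral_mono (hU.integrable_sq.const_mul _) hi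
    fun ω => le_bumpPotential hδ hb _) le_rfl

/-! ### Lower bounds for the three terms -/

section LowerBounds

variable {K τ R : ℕ} {rmax β D σ : ℝ}

theorem norm_toLp_zero_half (hD : 0 < D) :
    ‖(!₂[0, D / √2, D / √2] : EuclideanSpace ℝ (Fin 3))‖ = D := by
  rw [EuclideanSpace.norm_eq, Fin.sum_univ_three]
  simp only [Matrix.cons_val_zero, Matrix.cons_val_one, Matrix.cons_val, Real.norm_eq_abs, sq_abs,
    div_pow]
  rw [Real.sq_sqrt (by norm_num), show (0 : ℝ) ^ 2 + D ^ 2 / 2 + D ^ 2 / 2 = D ^ 2 by ring,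
    Real.sqrt_sq hD.le]

/-- Step sizes above `2 / L` fail on the steep coordinate. -/
theorem steep_lower_bound {a b δ μ L n η : ℝ} (hK : 1 ≤ K) (hδ : 0 < δ) (hb : 0 ≤ b) (hba : b ≤ a)
    (hμ : 0 ≤ μ) (hL : 0 < L) (hη : 2 ≤ η * L) :
    L * D ^ 2 / 4 ≤ ∫ ω, hardFunction a b δ μ L
      (localSGD η τ (fun _ : Fin K => hardGradient a b δ μ L n) ω !₂[0, D / √2, D / √2] R)
        ∂(gaussianSamples (Fin K × ℕ × ℕ)) := by
  refine le_trans ?_ (integral_hardFunction_localSGD_ge hK hδ hb)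
  have h1 : 0 ≤ (a - b) / 2 * (∫ ω, localSGD η τ (fun _ : Fin K => bumpGradient a b δ n) ω 0 R ^ 2
        ∂(gaussianSamples (Fin K × ℕ × ℕ))) :=
    mul_nonneg (by linarith) (integral_nonneg fun _ => sq_nonneg _)
  have h2 : 0 ≤ μ / 2 * ((1 - η * μ) ^ (τ * R) * (D / √2)) ^ 2 := by positivity
  have h3 : 1 ≤ ((1 - η * L) ^ (τ * R)) ^ 2 := by
    rw [pow_right_comm]
    exact one_le_pow₀ (by nlinarith)
  have h4 : L / 2 * ((1 - η * L) ^ (τ * R) * (D / √2)) ^ 2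
      = L * D ^ 2 / 4 * ((1 - η * L) ^ (τ * R)) ^ 2 := by
    rw [mul_pow, div_pow, Real.sq_sqrt (by norm_num)]
    ring
  have h5 : L * D ^ 2 / 4 * 1 ≤ L * D ^ 2 / 4 * ((1 - η * L) ^ (τ * R)) ^ 2 := by gcongr
  linarith

/-- Step sizes below `1 / (4 μ τ R)` fail on the flat coordinate. -/
theorem flat_lower_bound {a b δ μ L n η : ℝ} (hK : 1 ≤ K) (hδ : 0 < δ) (hb : 0 ≤ b) (hba : b ≤ a)
    (hμ : 0 ≤ μ) (hL : 0 < L) (hτ : 1 ≤ τ) (hR : 1 ≤ R)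
    (hη0 : 0 < η) (hη : 4 * (η * μ) * (τ * R) ≤ 1) :
    μ * D ^ 2 / 8 ≤ ∫ ω, hardFunction a b δ μ L
      (localSGD η τ (fun _ : Fin K => hardGradient a b δ μ L n) ω !₂[0, D / √2, D / √2] R)
        ∂(gaussianSamples (Fin K × ℕ × ℕ)) := by
  refine le_trans ?_ (integral_hardFunction_localSGD_ge hK hδ hb)
  have h1 : 0 ≤ (a - b) / 2 * (∫ ω, localSGD η τ (fun _ : Fin K => bumpGradient a b δ n) ω 0 R ^ 2
        ∂(gaussianSamples (Fin K × ℕ × ℕ))) :=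
    mul_nonneg (by linarith) (integral_nonneg fun _ => sq_nonneg _)
  have h2 : 0 ≤ L / 2 * ((1 - η * L) ^ (τ * R) * (D / √2)) ^ 2 := by positivity
  have hT : (1 : ℝ) ≤ τ * R := by exact_mod_cast Nat.mul_pos hτ hR
  have h0 : 0 ≤ η * μ := by positivity
  have h3 : 1 / 2 ≤ ((1 - η * μ) ^ (τ * R)) ^ 2 := by
    rw [← pow_mul]
    -- Bernoulli with exponent `2 * τ * R`: the squared contraction is at least `1 - 2 * (η * μ) *
    -- (τ * R) ≥ 1 / 2`.
    have := one_add_mul_le_pow (a := -(η * μ)) (by nlinarith) (τ * R * 2)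
    rw [← sub_eq_add_neg] at this
    refine le_trans ?_ this
    push_cast
    linarith
  have h4 : μ / 2 * ((1 - η * μ) ^ (τ * R) * (D / √2)) ^ 2
      = μ * D ^ 2 / 4 * ((1 - η * μ) ^ (τ * R)) ^ 2 := by
    rw [mul_pow, div_pow, Real.sq_sqrt (by norm_num)]
    ring
  have h5 : μ * D ^ 2 / 4 * (1 / 2) ≤ μ * D ^ 2 / 4 * ((1 - η * μ) ^ (τ * R)) ^ 2 := by gcongr
  linarith

/-- The bump coordinate contributes its second moment. -/
theorem bump_lower_bound {a b δ μ L n η : ℝ} (hK : 1 ≤ K) (hδ : 0 < δ) (hb : 0 ≤ b)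
    (hμ : 0 ≤ μ) (hL : 0 ≤ L) :
    (a - b) / 2 * (∫ ω, localSGD η τ (fun _ : Fin K => bumpGradient a b δ n) ω 0 R ^ 2
        ∂(gaussianSamples (Fin K × ℕ × ℕ))) ≤ ∫ ω, hardFunction a b δ μ L
      (localSGD η τ (fun _ : Fin K => hardGradient a b δ μ L n) ω !₂[0, D / √2, D / √2] R)
        ∂(gaussianSamples (Fin K × ℕ × ℕ)) := by
  refine le_trans ?_ (integral_hardFunction_localSGD_ge hK hδ hb)
  have h2 : 0 ≤ L / 2 * ((1 - η * L) ^ (τ * R) * (D / √2)) ^ 2 := by positivity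
  have h3 : 0 ≤ μ / 2 * ((1 - η * μ) ^ (τ * R) * (D / √2)) ^ 2 := by positivity
  linarith

/-- For this flat curvature the condition `4 * (η * μ) * (τ * R) ≤ 1` reads `η * L ≤ 2`, so every
step size fails on the steep or on the flat coordinate. -/
theorem optimization_lower_bound {L η : ℝ} (hK : 1 ≤ K) (hτ : 1 ≤ τ) (hR : 1 ≤ R) (hL : 0 < L)
    (hη : 0 < η) :
    L * D ^ 2 / (τ * R) / 64 ≤ ∫ ω, hardFunction 0 0 1 (L / (8 * (τ * R))) L
      (localSGD η τ (fun _ : Fin K => hardGradient 0 0 1 (L / (8 * (τ * R))) L 0) ω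
        !₂[0, D / √2, D / √2] R) ∂(gaussianSamples (Fin K × ℕ × ℕ)) := by
  have hT : (1 : ℝ) ≤ τ * R := by exact_mod_cast Nat.mul_pos hτ hR
  rcases le_total 2 (η * L) with h | h
  · refine le_trans ?_ (steep_lower_bound hK one_pos le_rfl le_rfl (by positivity) hL h)
    have : L * D ^ 2 / (τ * R) ≤ L * D ^ 2 := div_le_self (by positivity) hT
    have : 0 ≤ L * D ^ 2 := by positivity
    linarith
  · refine le_trans (le_of_eq ?_) (flat_lower_bound hK one_pos le_rfl le_rfl (by positivity) hL hτ hR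
      hη ?_)
    · field_simp
      norm_num
    · have : 4 * (η * (L / (8 * (τ * R)))) * (τ * R) = η * L / 2 := by field_simp; norm_num
      linarith

/-- The curvature `a = μ = n / (8 * D * S)` balances two losses: too small a step costs `μ * D ^ 2 /
8`, and otherwise `a * η * τ * R ≥ 1 / 4` forces accumulated noise energy of order `n ^ 2 / (a * S ^
2)`; both are of order `n * D / S`. -/
theorem statistical_lower_bound {L n η S : ℝ} (hK : 1 ≤ K) (hτ : 1 ≤ τ) (hR : 1 ≤ R) (hL : 0 < L)
    (hD : 0 < D) (hn : 0 < n) (hS : 0 < S) (hS2 : S ^ 2 = K * (τ * R)) (hnL : n ≤ L * D * S)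
    (hη : 0 < η) :
    n * D / S / 64 ≤ ∫ ω, hardFunction (n / (8 * D * S)) 0 1 (n / (8 * D * S)) L
      (localSGD η τ (fun _ : Fin K => hardGradient (n / (8 * D * S)) 0 1 (n / (8 * D * S)) L n) ω
        !₂[0, D / √2, D / √2] R) ∂(gaussianSamples (Fin K × ℕ × ℕ)) := by
  have hT : (1 : ℝ) ≤ τ * R := by exact_mod_cast Nat.mul_pos hτ hR
  have hT0 : (0 : ℝ) < τ * R := by linarith
  have hK0 : (0 : ℝ) < K := by exact_mod_cast hK
  have hnD : n * D / S ≤ L * D ^ 2 := by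
    rw [div_le_iff₀ hS]
    nlinarith [mul_le_mul_of_nonneg_right hnL hD.le]
  set a := n / (8 * D * S) with ha
  have ha0 : 0 < a := by positivity
  have haL : a ≤ L / 8 := by
    rw [ha, div_le_div_iff₀ (by positivity) (by norm_num)]
    linarith
  rcases le_total 2 (η * L) with h | h
  · refine le_trans ?_ (steep_lower_bound hK one_pos le_rfl ha0.le ha0.le hL h)
    have : 0 ≤ L * D ^ 2 := by positivity
    linarith
  rcases le_total (4 * (η * a) * (τ * R)) 1 with h' | h'
  · refine le_trans (le_of_eq ?_) (flat_lower_bound hK one_pos le_rfl ha0.le ha0.le hL hτ hR hη h')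
    rw [ha]
    field_simp
    norm_num
  · refine le_trans ?_ (bump_lower_bound hK one_pos le_rfl ha0.le hL.le)
    have haη : a * η ≤ 1 := by nlinarith
    have h1 := div_le_sum_one_sub_pow_two_mul (by positivity : 0 ≤ a * η) (τ * R)
    have h2 := integral_sq_localSGD_ge (η := η) (a := a) (n := n) (τ := τ) hK R
    push_cast at h1
    set x := a * η * (τ * R) with hx
    have hx1 : 1 ≤ 4 * x := by rw [hx]; linarith
    -- The function is increasing, with value `1 / 24` at `x = 1 / 4`.
    have h3 : 1 / 24 ≤ x ^ 2 / (1 + 2 * x) := by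
      rw [div_le_div_iff₀ (by norm_num) (by linarith)]
      nlinarith
    calc n * D / S / 64 ≤ n * D / S / 6 := by
          gcongr
          norm_num
      _ = n ^ 2 / (2 * a * K * (τ * R)) * (1 / 24) := by
          rw [ha]
          have : (K : ℝ) = S ^ 2 / (τ * R) := by rw [hS2]; field_simp
          rw [this]
          field_simp
          norm_num
      _ ≤ n ^ 2 / (2 * a * K * (τ * R)) * (x ^ 2 / (1 + 2 * x)) := by gcongr
      _ = (a - 0) / 2 * ((η * n) ^ 2 / K * (τ * R / (1 + 2 * (τ * R) * (a * η)))) := by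
          rw [show 2 * ((τ : ℝ) * R) * (a * η) = 2 * x by rw [hx]; ring, sub_zero]
          have : x ^ 2 = a ^ 2 * η ^ 2 * (τ * R) ^ 2 := by rw [hx]; ring
          rw [this]
          field_simp
      _ ≤ _ := by
          refine mul_le_mul_of_nonneg_left (le_trans ?_ h2) (by linarith)
          gcongr

/-- The scale `δ` is chosen such that half a round of noise spreads the iterates over it. -/
theorem two_mul_sq_le_noise {L σ η η₀ δ : ℝ} (hL : 0 < L) (hτ : 2 ≤ τ) (hη₀0 : 0 < η₀)
    (hηη : η₀ ≤ η) (hδ : δ ^ 2 = σ ^ 2 * η₀ ^ 2 * τ / (6 * (1 + L / 4 * η₀ * τ))) :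
    2 * δ ^ 2 ≤ (η * σ) ^ 2 * ∑ j ∈ Finset.range (τ / 2), ((1 - L / 8 * η) ^ 2) ^ j := by
  have hη : 0 < η := hη₀0.trans_le hηη
  have hτ0 : (0 : ℝ) < τ := by exact_mod_cast (by omega : 0 < τ)
  have h1 := div_le_sum_one_sub_pow_two_mul (by positivity : 0 ≤ L / 8 * η) (τ / 2)
  set s : ℝ := ((τ / 2 : ℕ) : ℝ) with hs
  -- Here `2 ≤ τ` is essential: for `τ = 1` the first half of the round would be empty.
  have hs3 : (τ : ℝ) ≤ 3 * s := by rw [hs]; exact_mod_cast (by omega : τ ≤ 3 * (τ / 2))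
  have hsτ : s ≤ τ := by rw [hs]; exact_mod_cast Nat.div_le_self τ 2
  have hs0 : 0 < s := by linarith
  calc 2 * δ ^ 2 = σ ^ 2 * (τ / 3 * (η₀ ^ 2 / (1 + L / 4 * η₀ * τ))) := by
        rw [hδ]; field_simp; ring
    _ ≤ σ ^ 2 * (s * (η₀ ^ 2 / (1 + L / 4 * η₀ * s))) := by
        gcongr
        linarith
    -- The map `η ↦ η ^ 2 / (1 + L / 4 * η * s)` is increasing, so the smallest relevant step size
    -- `η₀` decides.
    _ ≤ σ ^ 2 * (s * (η ^ 2 / (1 + L / 4 * η * s))) := by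
        gcongr σ ^ 2 * (s * ?_)
        rw [div_le_div_iff₀ (by positivity) (by positivity)]
        have e1 : η₀ ^ 2 ≤ η ^ 2 := by gcongr
        have e2 : 0 ≤ L / 4 * s * (η₀ * η * (η - η₀)) := by
          have := sub_nonneg.2 hηη
          positivity
        nlinarith
    _ = (η * σ) ^ 2 * (s / (1 + 2 * s * (L / 8 * η))) := by
        rw [show 2 * s * (L / 8 * η) = L / 4 * η * s by ring]
        ring
    _ ≤ _ := by gcongr

/-- The two noise entries of the minimum `B` match two regimes: if `L / 4 * η₀ * τ ≤ 1`, contraction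
within a round is negligible and `hB3` applies; otherwise the noise saturates and `hB2` applies. -/
theorem div_three_le_mul_sq {L B η₀ δ : ℝ} (hL : 0 < L) (hτ0 : (0 : ℝ) < τ) (hR0 : (0 : ℝ) < R)
    (hD : 0 < D) (hσ : 0 < σ) (hB : 0 < B) (hB3 : B ^ 3 * (τ * R ^ 2) ≤ L * σ ^ 2 * D ^ 4)
    (hB2 : B ^ 2 * (τ * R) ≤ σ ^ 2 * D ^ 2) (hη₀ : η₀ = 2 * D ^ 2 / (B * (τ * R)))
    (hδ : δ ^ 2 = σ ^ 2 * η₀ ^ 2 * τ / (6 * (1 + L / 4 * η₀ * τ))) : B / 3 ≤ L * δ ^ 2 := by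
  have hη₀0 : 0 < η₀ := by rw [hη₀]; positivity
  rw [hδ]
  rcases le_total (L / 4 * η₀ * τ) 1 with hp | hp
  · calc B / 3 ≤ L * σ ^ 2 * D ^ 4 / (3 * B ^ 2 * (τ * R ^ 2)) := by
          rw [div_le_div_iff₀ (by norm_num) (by positivity)]
          nlinarith
      _ = L * (σ ^ 2 * η₀ ^ 2 * τ / (6 * (1 + 1))) := by rw [hη₀]; field_simp; norm_num
      _ ≤ _ := by gcongr
  · calc B / 3 ≤ 2 * σ ^ 2 * D ^ 2 / (3 * (B * (τ * R))) := by
          rw [div_le_div_iff₀ (by norm_num) (by positivity)]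
          nlinarith [mul_pos (pow_pos hσ 2) (pow_pos hD 2)]
      _ = L * (σ ^ 2 * η₀ ^ 2 * τ / (6 * (L / 4 * η₀ * τ + L / 4 * η₀ * τ))) := by
          rw [hη₀]; field_simp; norm_num
      _ ≤ _ := by gcongr

/-- The flat curvature `B / (8 * D ^ 2)` makes step sizes below `η₀` lose `B / 64`. For larger ones,
up to `2 / L`, the noise fills the scale `δ` within half a round, and the resulting bias of order
`δ` costs order `L * δ ^ 2`, which is at least of order `B`. -/
theorem bias_lower_bound {L η B : ℝ} (hK : 1 ≤ K) (hτ : 2 ≤ τ) (hR : 1 ≤ R) (hL : 0 < L)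
    (hD : 0 < D) (hσ : 0 < σ) (hB : 0 < B) (hB3 : B ^ 3 * (τ * R ^ 2) ≤ L * σ ^ 2 * D ^ 4)
    (hB2 : B ^ 2 * (τ * R) ≤ σ ^ 2 * D ^ 2) (hB1 : B ≤ L * D ^ 2) {η₀ δ : ℝ}
    (hη₀ : η₀ = 2 * D ^ 2 / (B * (τ * R))) (hδ0 : 0 < δ)
    (hδ : δ ^ 2 = σ ^ 2 * η₀ ^ 2 * τ / (6 * (1 + L / 4 * η₀ * τ))) (hη : 0 < η) :
    B / 10 ^ 7 ≤ ∫ ω, hardFunction (L / 8) (L / 64) δ (B / (8 * D ^ 2)) L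
      (localSGD η τ (fun _ : Fin K => hardGradient (L / 8) (L / 64) δ (B / (8 * D ^ 2)) L σ) ω
        !₂[0, D / √2, D / √2] R) ∂(gaussianSamples (Fin K × ℕ × ℕ)) := by
  have hT : (1 : ℝ) ≤ τ * R := by exact_mod_cast Nat.mul_pos (by omega : 0 < τ) hR
  have hτ0 : (0 : ℝ) < τ := by exact_mod_cast (by omega : 0 < τ)
  have hR0 : (0 : ℝ) < R := by exact_mod_cast hR
  have hμ0 : 0 < B / (8 * D ^ 2) := by positivity
  have hη₀0 : 0 < η₀ := by rw [hη₀]; positivity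
  rcases le_total 2 (η * L) with h | h
  · refine le_trans ?_ (steep_lower_bound hK hδ0 (by positivity) (by linarith) hμ0.le hL h)
    linarith
  rcases le_total (4 * (η * (B / (8 * D ^ 2))) * (τ * R)) 1 with h' | h'
  · refine le_trans ?_ (flat_lower_bound hK hδ0 (by positivity) (by linarith) hμ0.le hL (by omega)
      hR hη h')
    have : B / (8 * D ^ 2) * D ^ 2 / 8 = B / 64 := by field_simp; norm_num
    linarith
  refine le_trans ?_ (bump_lower_bound hK hδ0 (by positivity) hμ0.le hL.le)
  have hηη : η₀ ≤ η := by
    rw [hη₀, div_le_iff₀ (by positivity)]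
    have : 4 * (η * (B / (8 * D ^ 2))) * (τ * R) = η * (B * (τ * R)) / (2 * D ^ 2) := by
      field_simp; norm_num
    rw [this, le_div_iff₀ (by positivity)] at h'
    linarith
  have haη : L / 8 * η ≤ 1 := by linarith
  have hs := two_mul_sq_le_noise hL hτ hη₀0 hηη hδ
  have hmean := integral_localSGD_le (K := K) (τ := τ) hK hδ0 (by positivity : 0 < L / 8)
    (by positivity : 0 ≤ L / 64) (by linarith) hη haη hs R
  set U := fun ω : Fin K × ℕ × ℕ → ℝ =>
    localSGD η τ (fun _ : Fin K => bumpGradient (L / 8) (L / 64) δ σ) ω 0 R with hU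
  have hUL : MemLp U 2 (gaussianSamples (Fin K × ℕ × ℕ)) := memLp_localSGD hδ0 0 R
  -- Since `B ≤ L * D ^ 2`, the flat curvature is at most `L / 8`; hence `L / 8 * η * (τ * R) ≥ 1 /
  -- 4`, and `1 / (1 + 1 / 4) = 4 / 5`.
  have hpow : (1 - L / 8 * η) ^ (τ * R) ≤ 4 / 5 := by
    refine (one_sub_pow_le_inv (by positivity) haη (τ * R)).trans ?_
    push_cast
    rw [div_le_div_iff₀ (by positivity) (by norm_num)]
    have h1 : B / (8 * D ^ 2) ≤ L / 8 := by
      rw [div_le_div_iff₀ (by positivity) (by norm_num)]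
      linarith
    have h2 : (η * (τ * R)) * (B / (8 * D ^ 2)) ≤ (η * (τ * R)) * (L / 8) := by gcongr
    linarith
  -- Here `320 = 64 * 5`: drift scale `δ / 64`, of which at least one fifth is reached.
  have hmean' : ∫ ω, U ω ∂(gaussianSamples (Fin K × ℕ × ℕ)) ≤ -(δ / 320) := by
    refine hmean.trans ?_
    have : L / 64 * δ / (8 * (L / 8)) = δ / 64 := by field_simp
    rw [this]
    nlinarith
  have hvar : (∫ ω, U ω ∂(gaussianSamples (Fin K × ℕ × ℕ))) ^ 2
      ≤ ∫ ω, U ω ^ 2 ∂(gaussianSamples (Fin K × ℕ × ℕ)) := by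
    have h1 := variance_eq_sub hUL
    have h2 := variance_nonneg U (gaussianSamples (Fin K × ℕ × ℕ))
    simp only [Pi.pow_apply] at h1
    linarith
  have hsq : (δ / 320) ^ 2 ≤ ∫ ω, U ω ^ 2 ∂(gaussianSamples (Fin K × ℕ × ℕ)) := by
    refine le_trans ?_ hvar
    have : 0 ≤ δ / 320 := by positivity
    nlinarith
  have hLδ := div_three_le_mul_sq hL hτ0 hR0 hD hσ hB hB3 hB2 hη₀ hδ
  calc B / 10 ^ 7 ≤ (L / 8 - L / 64) / 2 * (δ / 320) ^ 2 := by
        have : (L / 8 - L / 64) / 2 * (δ / 320) ^ 2 = 7 / (128 * 102400) * (L * δ ^ 2) := by ring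
        rw [this]
        linarith
    _ ≤ _ := by
        refine mul_le_mul_of_nonneg_left hsq (by linarith)

end LowerBounds

/-! ### Combination of the three bounds -/

theorem rpow_third_div_pow_three {x y : ℝ} (hx : 0 ≤ x) (hy : 0 ≤ y) :
    (x ^ (1 / 3 : ℝ) / y ^ (2 / 3 : ℝ)) ^ 3 = x / y ^ 2 := by
  rw [div_pow, ← Real.rpow_natCast, ← Real.rpow_natCast (y ^ (2 / 3 : ℝ)), ← Real.rpow_mul hx,
    ← Real.rpow_mul hy, ← Real.rpow_natCast y 2]
  norm_num

theorem mainTheorem6 :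
    ∃ c : ℝ, 0 < c ∧
      ∀ (K τ R : ℕ) (rmax β D σ : ℝ),
        1 ≤ K → 2 ≤ τ → 1 ≤ R → (K : ℝ) ≤ rmax → 0 < β → 0 < D → 0 < σ →
        ∃ (I : IWERMProblem K) (G : I.StochasticGradient σ) (w₀ wStar : I.W),
          IsLUB I.ratioValues rmax ∧
          (∀ k y, I.weight k y = I.trueRatio k y) ∧
          I.ConvexSmoothC2 β ∧
          (∀ k k', I.localObjective k = I.localObjective k') ∧
          IsMinOn I.objective Set.univ wStar ∧
          ‖w₀ - wStar‖ = D ∧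
          (∀ η : ℝ, 0 < η →
            c * (rmax * β * D ^ 2 / (τ * R)
              + min ((rmax * β * σ ^ 2 * D ^ 4) ^ (1 / 3 : ℝ) / (√τ * R) ^ (2 / 3 : ℝ))
                  (min (σ * D / √(τ * R)) (rmax * β * D ^ 2))
              + min (σ * D / √(K * τ * R)) (rmax * β * D ^ 2))
            ≤ expectedSuboptimality G η τ R w₀ wStar) ∧
          (τ * (rmax * β * D) ^ 2 ≤ σ ^ 2 * R →
            σ ^ 2 ≤ (rmax * β * D) ^ 2 * τ * R ^ 2 →
            σ ^ 2 ≤ (rmax * β * D) ^ 2 * K * τ * R →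
            ∀ η : ℝ, 0 < η →
              c * (rmax * β * D ^ 2 / (τ * R)
                + (rmax * β * σ ^ 2 * D ^ 4) ^ (1 / 3 : ℝ) / (√τ * R) ^ (2 / 3 : ℝ)
                + σ * D / √(K * τ * R))
              ≤ expectedSuboptimality G η τ R w₀ wStar) := by
  -- The largest term is at least a third of the sum, and the weakest of the three bounds has
  -- constant `1 / 10 ^ 7`.
  refine ⟨1 / 10 ^ 8, by norm_num, ?_⟩
  intro K τ R rmax β D σ hK hτ hR hr hβ hD hσ
  have hK0 : (0 : ℝ) < K := by exact_mod_cast hK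
  have hτ0 : (0 : ℝ) < τ := by exact_mod_cast (by omega : 0 < τ)
  have hR0 : (0 : ℝ) < R := by exact_mod_cast hR
  have hr0 : 0 < rmax := hK0.trans_le hr
  have hτ1 : 1 ≤ τ := by omega
  have hT : (1 : ℝ) ≤ τ * R := by exact_mod_cast Nat.mul_pos hτ1 hR
  have hL : 0 < rmax * β := by positivity
  set X := (rmax * β * σ ^ 2 * D ^ 4) ^ (1 / 3 : ℝ) / (√τ * R) ^ (2 / 3 : ℝ) with hX
  have hX0 : 0 < X := by positivity
  have hX3 : X ^ 3 = rmax * β * σ ^ 2 * D ^ 4 / (τ * R ^ 2) := by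
    rw [hX, rpow_third_div_pow_three (by positivity) (by positivity), mul_pow,
      Real.sq_sqrt hτ0.le]
  set S := √(K * τ * R) with hS
  have hS0 : 0 < S := Real.sqrt_pos.2 (by positivity)
  have hS2 : S ^ 2 = K * (τ * R) := by rw [hS, Real.sq_sqrt (by positivity), mul_assoc]
  set Y := σ * D / √(τ * R) with hY
  have hY0 : 0 < Y := by positivity
  have hY2 : Y ^ 2 = σ ^ 2 * D ^ 2 / (τ * R) := by
    rw [hY, div_pow, mul_pow, Real.sq_sqrt (by positivity)]
  set A := rmax * β * D ^ 2 / (τ * R) with hA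
  set Z := rmax * β * D ^ 2 with hZ
  have hZ0 : 0 < Z := by positivity
  set B := min X (min Y Z) with hB
  have hB0 : 0 < B := lt_min hX0 (lt_min hY0 hZ0)
  set C := min (σ * D / S) Z with hC
  have hmain : ∃ (I : IWERMProblem K) (G : I.StochasticGradient σ) (w₀ wStar : I.W),
      IsLUB I.ratioValues rmax ∧
      (∀ k y, I.weight k y = I.trueRatio k y) ∧
      I.ConvexSmoothC2 β ∧
      (∀ k k', I.localObjective k = I.localObjective k') ∧
      IsMinOn I.objective Set.univ wStar ∧
      ‖w₀ - wStar‖ = D ∧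
      ∀ η : ℝ, 0 < η → 1 / 10 ^ 8 * (A + B + C) ≤ expectedSuboptimality G η τ R w₀ wStar := by
    have hA0 : 0 < A := by positivity
    have hC0 : 0 < C := lt_min (by positivity) hZ0
    by_cases hcase : B ≤ A ∧ C ≤ A
    · have hμ : rmax * β / (8 * (τ * R)) ≤ rmax * β := div_le_self hL.le (by linarith)
      refine exists_problem_of_le hK hr hβ one_pos le_rfl le_rfl (by linarith) (by positivity) hμ
        le_rfl hσ.le (norm_toLp_zero_half hD) fun η hη =>
        le_trans ?_ (optimization_lower_bound hK hτ1 hR hL hη)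
      linarith [hcase.1, hcase.2]
    by_cases hcase' : B ≤ C
    -- Truncating the noise level at `rmax * β * D * S` turns `n * D / S` into the minimum `C`.
    · set n := min σ (rmax * β * D * S) with hn
      have hn0 : 0 < n := lt_min hσ (by positivity)
      have hnC : n * D / S = C := by
        rw [hn, hC, min_mul_of_nonneg _ _ hD.le, ← min_div_div_right hS0.le]
        congr 1
        rw [hZ]
        field_simp
      have hnL : n ≤ rmax * β * D * S := min_le_right _ _
      have hμ : n / (8 * D * S) ≤ rmax * β := by
        rw [div_le_iff₀ (by positivity)]
        have : 0 < rmax * β * D * S := by positivity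
        nlinarith
      refine exists_problem_of_le hK hr hβ one_pos le_rfl (by positivity) (by linarith)
        (by positivity) hμ hn0.le (min_le_left _ _) (norm_toLp_zero_half hD) fun η hη =>
        le_trans ?_ (statistical_lower_bound hK hτ1 hR hL hD hn0 hS0 hS2 hnL hη)
      rw [hnC]
      have : A ≤ C := by
        by_contra hlt
        exact hcase ⟨by linarith, by linarith⟩
      linarith
    · have hB3 : B ^ 3 * (τ * R ^ 2) ≤ rmax * β * σ ^ 2 * D ^ 4 := by
        rw [← le_div_iff₀ (by positivity), ← hX3]
        exact pow_le_pow_left₀ hB0.le (min_le_left _ _) 3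
      have hB2 : B ^ 2 * (τ * R) ≤ σ ^ 2 * D ^ 2 := by
        rw [← le_div_iff₀ (by positivity), ← hY2]
        exact pow_le_pow_left₀ hB0.le ((min_le_right _ _).trans (min_le_left _ _)) 2
      have hB1 : B ≤ rmax * β * D ^ 2 := (min_le_right _ _).trans (min_le_right _ _)
      have hμ : B / (8 * D ^ 2) ≤ rmax * β := by
        rw [div_le_iff₀ (by positivity)]
        linarith
      set η₀ := 2 * D ^ 2 / (B * (τ * R)) with hη₀
      have hη₀0 : 0 < η₀ := by positivity
      set δ := √(σ ^ 2 * η₀ ^ 2 * τ / (6 * (1 + rmax * β / 4 * η₀ * τ))) with hδ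
      have hδ0 : 0 < δ := Real.sqrt_pos.2 (by positivity)
      refine exists_problem_of_le hK hr hβ hδ0 (by positivity : 0 ≤ rmax * β / 64) (by linarith)
        (by linarith) (by positivity) hμ hσ.le le_rfl (norm_toLp_zero_half hD) fun η hη =>
        le_trans ?_ (bias_lower_bound hK hτ hR hL hD hσ hB0 hB3 hB2 hB1 hη₀ hδ0
          (Real.sq_sqrt (by positivity)) hη)
      have : A ≤ B := by
        by_contra hlt
        exact hcase ⟨by linarith, by linarith⟩
      linarith
  obtain ⟨I, G, w₀, wStar, h1, h2, h3, h4, h5, h6, h7⟩ := hmain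
  refine ⟨I, G, w₀, wStar, h1, h2, h3, h4, h5, h6, h7, fun e1 e2 e3 η hη => ?_⟩
  -- The three conditions say exactly that the first entry of each minimum is the smallest; sixth
  -- powers clear the cube and square roots.
  have hXY : X ≤ Y := by
    refine le_of_pow_le_pow_left₀ (n := 6) (by norm_num) hY0.le ?_
    rw [show X ^ 6 = (X ^ 3) ^ 2 by ring, show Y ^ 6 = (Y ^ 2) ^ 3 by ring, hX3, hY2, div_pow,
      div_pow, div_le_div_iff₀ (by positivity) (by positivity)]
    calc (rmax * β * σ ^ 2 * D ^ 4) ^ 2 * (τ * R) ^ 3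
        = σ ^ 4 * D ^ 6 * τ ^ 2 * R ^ 3 * (τ * (rmax * β * D) ^ 2) := by ring
      _ ≤ σ ^ 4 * D ^ 6 * τ ^ 2 * R ^ 3 * (σ ^ 2 * R) := by gcongr
      _ = (σ ^ 2 * D ^ 2) ^ 3 * (τ * R ^ 2) ^ 2 := by ring
  have hXZ : X ≤ Z := by
    refine le_of_pow_le_pow_left₀ (n := 3) (by norm_num) hZ0.le ?_
    rw [hX3, div_le_iff₀ (by positivity)]
    calc rmax * β * σ ^ 2 * D ^ 4
        ≤ rmax * β * ((rmax * β * D) ^ 2 * τ * R ^ 2) * D ^ 4 := by gcongr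
      _ = Z ^ 3 * (τ * R ^ 2) := by rw [hZ]; ring
  have hSZ : σ * D / S ≤ Z := by
    rw [div_le_iff₀ hS0]
    refine le_of_pow_le_pow_left₀ (n := 2) (by norm_num) (by positivity) ?_
    rw [mul_pow Z, hS2]
    calc (σ * D) ^ 2 = σ ^ 2 * D ^ 2 := by ring
      _ ≤ (rmax * β * D) ^ 2 * K * τ * R * D ^ 2 := by gcongr
      _ = Z ^ 2 * (K * (τ * R)) := by rw [hZ]; ring
  have h := h7 η hη
  rwa [hB, hC, min_eq_left (le_min hXY hXZ), min_eq_left hSZ] at h
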